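/- For every $k\in\mathbb N$ let a split-plot design be given: $a\ge 1$ groups, sample sizes $n_1,\dots,n_a\ge 1$, dimensions $d_1,\dots,d_a\ge 1$, mean vectors $\mu_i\in\mathbb R^{d_i}$, positive definite covariance matrices $\Sigma_i\in\mathbb R^{d_i\times d_i}$, and independent observations $X_{i,j}\sim\mathcal N_{d_i}(\mu_i,\Sigma_i)$, $j=1,\dots,n_i$, $i=1,\dots,a$ (all of these depend on $k$). Put $N=\sum_i n_i$, $D=\sum_i d_i$, $\mu=(\mu_1^\top,\dots,\mu_a^\top)^\top$, $V_N=\bigoplus_{i=1}^a\frac{N}{n_i}\Sigma_i$, and let $T\in\mathbb R^{D\times D}$ be a symmetric idempotent matrix, $T\neq 0$. Assume the null hypothesis $\mathcal H_0(T): T\mu=0$, and assume that, as $k\to\infty$, one of the following frameworks holds: 1. $a$ is fixed and $\min(\max_i d_i,n_1,\dots,n_a)\to\infty$; 2. each $d_i$ is fixed (does not depend on $k$) and $\min(a,n_1,\dots,n_a)\to\infty$; 3. $\min(a,\max_i d_i,n_1,\dots,n_a)\to\infty$. Let $\overline X$ be the pooled vector of the group means $\overline X_i=n_i^{-1}\sum_j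 X_{i,j}$, let $Q_N=N\,\overline X^\top T\,\overline X$ and $$\widetilde W_N=\frac{Q_N-\mathbb E_{\mathcal H_0}(Q_N)}{\sqrt{\operatorname{Var}_{\mathcal H_0}(Q_N)}} .$$ For index vectors $\ell_s=(\ell_{s,1},\dots,\ell_{s,a})$ with $\ell_{s,i}\in\{1,\dots,n_i\}$, let $Z_{(\ell_s,\ell_t)}\in\mathbb R^D$ be the vector with blocks $\sqrt{N/n_i}\,(X_{i,\ell_{s,i}}-X_{i,\ell_{t,i}})$, $i=1,\dots,a$, and define $$A_1=\sum_{\ell_1,\ell_2}\frac{Z_{(\ell_1,\ell_2)}^\top T Z_{(\ell_1,\ell_2)}}{2\prod_{i=1}^a\binom{n_i}{2}},\qquad A_2=\sum_{\ell_1,\dots,\ell_4}\frac{\big[Z_{(\ell_1,\ell_2)}^\top T Z_{(\ell_3,\ell_4)}\big]^2}{4\prod_{i=1}^a 6\binom{n_i}{4}},$$ where the first sum is over all $\ell_1,\ell_2$ with $\ell_{1,i}<\ell_{2,i}$ for all $i$, and the second over all $\ell_1,\dots,\ell_4$ such that, for all $i$, $\ell_{1,i},\dots,\ell_{4,i}$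 are pairwise distinct, $\ell_{1,i}<\ell_{2,i}$ and $\ell_{3,i}<\ell_{4,i}$. For $m\in\{2,4\}$ and $\Upsilon\in\mathbb N$ let, independently over $\upsilon=1,\dots,\Upsilon$ and $i=1,\dots,a$ and independently of the data, $(\sigma^{(m)}_{1i}(\upsilon),\dots,\sigma^{(m)}_{mi}(\upsilon))$ be a listing of a uniformly drawn random $m$-element subset of $\{1,\dots,n_i\}$, let $\sigma^{(m)}_s(\upsilon)=(\sigma^{(m)}_{s1}(\upsilon),\dots,\sigma^{(m)}_{sa}(\upsilon))$, and define $$A_1^\star(\Upsilon)=\frac1{2\Upsilon}\sum_{\upsilon=1}^{\Upsilon}Z_{(\sigma^{(2)}_1(\upsilon),\sigma^{(2)}_2(\upsilon))}^\top T Z_{(\sigma^{(2)}_1(\upsilon),\sigma^{(2)}_2(\upsilon))},\qquad A_2^\star(\Upsilon)=\frac1{4\Upsilon}\sum_{\upsilon=1}^{\Upsilon}\big[Z_{(\sigma^{(4)}_1(\upsilon),\sigma^{(4)}_2(\upsilon))}^\top T Z_{(\sigma^{(4)}_3(\upsilon),\sigma^{(4)}_4(\upsilon))}\big]^2 .$$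 Put $W_N=(Q_N-A_1)/\sqrt{2A_2}$ and $W_N^\star=(Q_N-A_1^\star(\Upsilon))/\sqrt{2A_2^\star(\Upsilon)}$. Assume $$\prod_{i=1}^a\frac{(n_i-2)!\,(n_i-2)!}{n_i!\,(n_i-4)!}\to1\qquad\text{and}\qquad \prod_{i=1}^a\frac{(n_i-4)!\,(n_i-4)!}{n_i!\,(n_i-8)!}\to1 ,$$ and, for the statement about $W_N^\star$, that $\Upsilon=\Upsilon_k\to\infty$. Let $\lambda_1\ge\dots\ge\lambda_D$ be the eigenvalues of $TV_NT$, let $\beta_s=\lambda_s/\sqrt{\sum_{\ell=1}^D\lambda_\ell^2}$ for $s\le D$ and $\beta_s=0$ for $s>D$, and assume that $\beta_s\to b_s$ for every $s\in\mathbb N$, for a decreasing sequence $(b_s)_s$. Let $C_1,C_2,\dots\sim\chi^2_1$ and $Z\sim\mathcal N(0,1)$ be independent. Then $W_N$ and $W_N^\star$ have the same limit distribution as $\widetilde W_N$. More precisely: (a) If $b_s\in[0,1]$ for all $s$, then $\sum_s b_s^2\le1$ and, with $r=\#\{s:b_s\ne0\}\in\mathbb N\cup\{0,\infty\}$, the series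 $\sum_{s=1}^r b_s(C_s-1)/\sqrt2$ converges almost surely, and $\widetilde W_N$, $W_N$ and $W_N^\star$ all converge in distribution to $$\sum_{s=1}^r b_s\frac{C_s-1}{\sqrt2}+\sqrt{1-\sum_{s=1}^r b_s^2}\cdot Z .$$ (b) If $b_s\in(0,1)$ for all $s$ and $\sum_{s=1}^\infty b_s^2=1$, then the series $\sum_{s=1}^\infty b_s(C_s-1)/\sqrt2$ converges almost surely, and $\widetilde W_N$, $W_N$ and $W_N^\star$ all converge in distribution to it. -/

import Mathlib

open MeasureTheory ProbabilityTheory Filter Topology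
open scoped Matrix Nat

noncomputable section

/-- The deterministic data of a split-plot design: `a` groups, group `i` has `n i` independent
subjects with `d i`-dimensional normal observations of mean `mean i` and positive definite
covariance matrix `cov i`; `T` is the hypothesis matrix, a symmetric idempotent matrix acting on
the pooled space of dimension `d 0 + ... + d (a - 1)`, whose coordinates are the pairs `⟨i, t⟩`
with `i` a group and `t` a coordinate of group `i`. -/
structure SplitPlotDesign where
  a : ℕ
  a_pos : 0 < a
  d : Fin a → ℕ
  d_pos : ∀ i, 0 < d i
  n : Fin a → ℕ
  n_pos : ∀ i, 0 < n i
  mean : (i : Fin a) → EuclideanSpace ℝ (Fin (d i))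
  cov : (i : Fin a) → Matrix (Fin (d i)) (Fin (d i)) ℝ
  cov_posDef : ∀ i, (cov i).PosDef
  T : Matrix (Σ i : Fin a, Fin (d i)) (Σ i : Fin a, Fin (d i)) ℝ
  T_symm : T.IsSymm
  T_idem : IsIdempotentElem T

namespace SplitPlotDesign

variable (D : SplitPlotDesign)

/-- Coordinates of the pooled space. -/
abbrev Idx : Type := Σ i : Fin D.a, Fin (D.d i)

/-- Total number `N` of observation vectors. -/
def N : ℕ := ∑ i, D.n i

/-- Pooled mean vector `μ`. -/
def pooledMean : D.Idx → ℝ := fun p => D.mean p.1 p.2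

/-- The null hypothesis `T μ = 0`. -/
def NullHypothesis : Prop := D.T *ᵥ D.pooledMean = 0

/-- The block diagonal matrix `V_N` with blocks `(N / n_i) Σ_i`. -/
def V : Matrix D.Idx D.Idx ℝ :=
  Matrix.blockDiagonal' fun i => ((D.N : ℝ) / (D.n i : ℝ)) • D.cov i

theorem isHermitian_TVT : (D.T * D.V * D.T).IsHermitian := by
  have hV : (D.V)ᴴ = D.V := by
    unfold V
    rw [Matrix.blockDiagonal'_conjTranspose]
    congr 1
    funext i
    rw [Matrix.conjTranspose_smul, (D.cov_posDef i).isHermitian.eq]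
    simp
  have hT : (D.T)ᴴ = D.T := by
    rw [Matrix.conjTranspose_eq_transpose_of_trivial]
    exact D.T_symm
  unfold Matrix.IsHermitian
  rw [Matrix.conjTranspose_mul, Matrix.conjTranspose_mul, hT, hV, Matrix.mul_assoc]

/-- The eigenvalues of `T V_N T` with multiplicity, in decreasing order (indexed from `0`). -/
def eigenval : Fin (Fintype.card D.Idx) → ℝ := D.isHermitian_TVT.eigenvalues₀

/-- The standardized eigenvalues `λ_s / √(∑ λ_ℓ²)` in decreasing order, indexed from `s = 0`, and
continued by `0` beyond the dimension of the pooled space. -/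
def beta (s : ℕ) : ℝ :=
  if h : s < Fintype.card D.Idx then
    D.eigenval ⟨s, h⟩ / √(∑ l, D.eigenval l ^ 2)
  else 0

/-- A choice of one observation vector for every subject of every group. -/
abbrev Data : Type := (i : Fin D.a) → Fin (D.n i) → EuclideanSpace ℝ (Fin (D.d i))

/-- The pooled vector of group means. -/
def pooledSampleMean (x : D.Data) : D.Idx → ℝ :=
  fun p => (D.n p.1 : ℝ)⁻¹ * ∑ j, x p.1 j p.2

/-- The quadratic form `Q_N`. -/
def Q (x : D.Data) : ℝ :=
  (D.N : ℝ) * (D.pooledSampleMean x ⬝ᵥ D.T *ᵥ D.pooledSampleMean x)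

/-- The pooled difference vector `Z_{(ℓ₁, ℓ₂)}`: subject `ℓ₁ i` minus subject `ℓ₂ i` in group `i`,
scaled by `√(N / n_i)`. -/
def Z (x : D.Data) (l₁ l₂ : (i : Fin D.a) → Fin (D.n i)) : D.Idx → ℝ :=
  fun p => √((D.N : ℝ) / (D.n p.1 : ℝ)) * (x p.1 (l₁ p.1) p.2 - x p.1 (l₂ p.1) p.2)

open Classical in
/-- The trace estimator `A₁`. -/
def A1 (x : D.Data) : ℝ :=
  ∑ l : Fin 2 → (i : Fin D.a) → Fin (D.n i) with ∀ i, l 0 i < l 1 i,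
    (D.Z x (l 0) (l 1) ⬝ᵥ D.T *ᵥ D.Z x (l 0) (l 1)) /
      (2 * ∏ i, ((D.n i).choose 2 : ℝ))

open Classical in
/-- The trace estimator `A₂`: in each group the four indices are pairwise distinct and the two
pairs are ordered. -/
def A2 (x : D.Data) : ℝ :=
  ∑ l : Fin 4 → (i : Fin D.a) → Fin (D.n i) with
      ∀ i, Function.Injective (fun s => l s i) ∧ l 0 i < l 1 i ∧ l 2 i < l 3 i,
    (D.Z x (l 0) (l 1) ⬝ᵥ D.T *ᵥ D.Z x (l 2) (l 3)) ^ 2 /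
      (4 * ∏ i, (6 * ((D.n i).choose 4 : ℝ)))

/-- The subsampling version of `A₁` with `U` summands, for the index tuples `σ u i`. -/
def A1star (x : D.Data) {U : ℕ} (σ : Fin U → (i : Fin D.a) → Fin 2 → Fin (D.n i)) : ℝ :=
  (1 / (2 * (U : ℝ))) * ∑ u,
    (D.Z x (fun i => σ u i 0) (fun i => σ u i 1) ⬝ᵥ
      D.T *ᵥ D.Z x (fun i => σ u i 0) (fun i => σ u i 1))

/-- The subsampling version of `A₂` with `U` summands, for the index tuples `σ u i`. -/
def A2star (x : D.Data) {U : ℕ} (σ : Fin U → (i : Fin D.a) → Fin 4 → Fin (D.n i)) : ℝ :=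
  (1 / (4 * (U : ℝ))) * ∑ u,
    (D.Z x (fun i => σ u i 0) (fun i => σ u i 1) ⬝ᵥ
      D.T *ᵥ D.Z x (fun i => σ u i 2) (fun i => σ u i 3)) ^ 2

section Random

variable {Ω : Type*} [MeasurableSpace Ω] (P : Measure Ω)

/-- The observations `X i j` are independent, and `X i j` is normal with mean `mean i` and
covariance matrix `cov i`. -/
structure IsSample (X : (i : Fin D.a) → Fin (D.n i) → Ω → EuclideanSpace ℝ (Fin (D.d i))) :
    Prop where
  hasLaw : ∀ i j, HasLaw (X i j) (multivariateGaussian (D.mean i) (D.cov i)) P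
  indep : iIndepFun (fun q : (Σ i : Fin D.a, Fin (D.n i)) => X q.1 q.2) P

/-- For each `u` and each group `i`, independently over `u` and `i`, `σ u i` lists (in an order
that need not be specified) a random `m`-element subsample of the `n i` subjects of group `i`,
drawn uniformly from all `m`-element subsets; the drawings are independent of the data `X`. -/
structure IsSubsampling (X : (i : Fin D.a) → Fin (D.n i) → Ω → EuclideanSpace ℝ (Fin (D.d i)))
    (m U : ℕ) (σ : Fin U → (i : Fin D.a) → Ω → Fin m → Fin (D.n i)) : Prop where
  aemeasurable : ∀ u i, AEMeasurable (σ u i) P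
  indep : iIndepFun (fun q : Fin U × Fin D.a => σ q.1 q.2) P
  uniform : ∀ u i (S : Finset (Fin (D.n i))), S.card = m →
    P {ω | Finset.univ.image (σ u i ω) = S} = ((D.n i).choose m : ENNReal)⁻¹
  indep_data : IndepFun (fun ω (q : Fin U × Fin D.a) => σ q.1 q.2 ω)
    (fun ω (q : Σ i : Fin D.a, Fin (D.n i)) => X q.1 q.2 ω) P

/-- The standardized quadratic form `(Q_N - E(Q_N)) / √Var(Q_N)`. Expectation and variance are
those under `P`; they are the null expectation and null variance when the null hypothesis holds. -/
def Wtilde (X : (i : Fin D.a) → Fin (D.n i) → Ω → EuclideanSpace ℝ (Fin (D.d i))) (ω : Ω) : ℝ :=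
  (D.Q (fun i j => X i j ω) - ∫ ω', D.Q (fun i j => X i j ω') ∂P) /
    √(variance (fun ω' => D.Q (fun i j => X i j ω')) P)

/-- The studentized statistic `W_N`. -/
def W (X : (i : Fin D.a) → Fin (D.n i) → Ω → EuclideanSpace ℝ (Fin (D.d i))) (ω : Ω) : ℝ :=
  (D.Q (fun i j => X i j ω) - D.A1 (fun i j => X i j ω)) / √(2 * D.A2 (fun i j => X i j ω))

/-- The studentized statistic based on the subsampling estimators. -/
def Wstar (X : (i : Fin D.a) → Fin (D.n i) → Ω → EuclideanSpace ℝ (Fin (D.d i))) {U : ℕ}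
    (σ : Fin U → (i : Fin D.a) → Ω → Fin 2 → Fin (D.n i))
    (τ : Fin U → (i : Fin D.a) → Ω → Fin 4 → Fin (D.n i)) (ω : Ω) : ℝ :=
  (D.Q (fun i j => X i j ω) - D.A1star (fun i j => X i j ω) (fun u i => σ u i ω)) /
    √(2 * D.A2star (fun i j => X i j ω) (fun u i => τ u i ω))

end Random

/-- First framework: the number of groups is fixed, the largest dimension and the smallest group
size tend to infinity. -/
def Framework1 (D : ℕ → SplitPlotDesign) : Prop :=
  (∃ a₀, ∀ k, (D k).a = a₀) ∧
    Tendsto (fun k => min (⨆ i, (D k).d i) (⨅ i, (D k).n i)) atTop atTop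

/-- Second framework: the dimension of each group is fixed, the number of groups and the smallest
group size tend to infinity. -/
def Framework2 (D : ℕ → SplitPlotDesign) : Prop :=
  (∃ d₀ : ℕ → ℕ, ∀ k (i : Fin (D k).a), (D k).d i = d₀ i) ∧
    Tendsto (fun k => min (D k).a (⨅ i, (D k).n i)) atTop atTop

/-- Third framework: the number of groups, the largest dimension and the smallest group size tend
to infinity. -/
def Framework3 (D : ℕ → SplitPlotDesign) : Prop :=
  Tendsto (fun k => min (D k).a (min (⨆ i, (D k).d i) (⨅ i, (D k).n i))) atTop atTop

/-- Condition on the group sizes for the estimators with `m` distinct indices per group: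
`∏ ((n_i - m)! (n_i - m)!) / (n_i! (n_i - 2 m)!) → 1`. -/
def SizeCondition (m : ℕ) (D : ℕ → SplitPlotDesign) : Prop :=
  Tendsto (fun k => ∏ i, ((((D k).n i - m)! : ℝ) * (((D k).n i - m)! : ℝ)) /
    (((D k).n i)! * (((D k).n i - 2 * m)! : ℝ))) atTop (𝓝 1)

/-- The distribution of the random variable `L` is the common limit distribution of the
standardized quadratic form, of the studentized statistic, and of every subsampling version of the
latter whose number `U k` of summands tends to infinity. -/
def IsCommonLimit {Ω : ℕ → Type*} [∀ k, MeasurableSpace (Ω k)]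
    (P : (k : ℕ) → Measure (Ω k)) [∀ k, IsProbabilityMeasure (P k)]
    (D : ℕ → SplitPlotDesign)
    (X : (k : ℕ) → (i : Fin (D k).a) → Fin ((D k).n i) → Ω k → EuclideanSpace ℝ (Fin ((D k).d i)))
    {Ω' : Type*} [MeasurableSpace Ω'] (P' : Measure Ω') [IsProbabilityMeasure P']
    (L : Ω' → ℝ) : Prop :=
  TendstoInDistribution (fun k => (D k).Wtilde (P k) (X k)) atTop L P P' ∧
  TendstoInDistribution (fun k => (D k).W (X k)) atTop L P P' ∧
  ∀ U : ℕ → ℕ, Tendsto U atTop atTop →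
    ∀ σ : (k : ℕ) → Fin (U k) → (i : Fin (D k).a) → Ω k → Fin 2 → Fin ((D k).n i),
    (∀ k, (D k).IsSubsampling (P k) (X k) 2 (U k) (σ k)) →
    ∀ τ : (k : ℕ) → Fin (U k) → (i : Fin (D k).a) → Ω k → Fin 4 → Fin ((D k).n i),
    (∀ k, (D k).IsSubsampling (P k) (X k) 4 (U k) (τ k)) →
    TendstoInDistribution (fun k => (D k).Wstar (X k) (σ k) (τ k)) atTop L P P'

end SplitPlotDesign

/-- The chi-squared distribution with one degree of freedom. -/
def chiSquaredOne : Measure ℝ := (gaussianReal 0 1).map (fun x => x ^ 2)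

end

/-!
Let `λ s` be the eigenvalues of `T V_N T`. Under the null hypothesis, the quadratic form `Q_N` is a
sum of squares of the coordinates of a Gaussian vector in an eigenbasis of `T V_N T`, and these
coordinates (the *scores*) are independent with variances `λ s`. So `Q_N` has mean `∑ λ s` and
variance `2 ∑ λ s ^ 2`, and the standardized form has the law of `∑ β s (C s - 1) / √2` with
independent chi-squared variables `C s` (`IsSample.charFun_quadratic`).

*The standardized form.* The coefficients `β s` decrease in `s` and their squares sum to one, so all
but finitely many of them are uniformly small. The finitely many large ones converge; the remaining
terms behave like a Gaussian variable with the remaining variance, since a standardized chi-squared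
variable and a standard normal one have characteristic functions that agree up to `o(t ^ 2)` at the
origin (`tendsto_prod_charFun`). Letting the number of separated terms grow gives the limit
`∑ b s (C s - 1) / √2 + √(1 - ∑ b s ^ 2) Z`
(`tendsto_charFun_sum_chiSquared_add_gaussian`), where the series converges almost surely because it
is an `L²`-bounded martingale (`exists_ae_tendsto_sum_of_summable_variance`). The case
`∑ b s ^ 2 = 1` is the one in which the Gaussian part vanishes.

*The estimators.* `A₁` and its subsampling version are averages of statistics that depend on two
subjects per group and have mean `∑ λ s` and variance `2 ∑ λ s ^ 2`; `A₂` and its subsampling version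
are averages of statistics that depend on four subjects per group, have mean `∑ λ s ^ 2` and a
variance of at most `9 (∑ λ s ^ 2) ^ 2`. Statistics without common subjects are uncorrelated. By
Chebyshev's inequality the relative error of the average is controlled by the probability that two
independent subsamples have a common subject (`IsUnbiasedKernel.measureReal_average_le`); for random
subsamples one argues conditionally on the subsamples, and the diagonal contributes another
`1 / U` (`IsUnbiasedKernel.measureReal_subsample_le`). The probability of disjointness is at least
the product in the size condition, which tends to one. So the estimators are ratio-consistent, at
the scale of the standard deviation in the case of `A₁`, and a Slutsky argument transfers the limit
to the studentized statistics (`tendstoInDistribution_studentized`).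
-/

/-! ### Products of characteristic functions and Slutsky's theorem -/

theorem norm_prod_sub_prod_le_sum {ι : Type*} (s : Finset ι) (f g : ι → ℂ)
    (hf : ∀ i ∈ s, ‖f i‖ ≤ 1) (hg : ∀ i ∈ s, ‖g i‖ ≤ 1) :
    ‖∏ i ∈ s, f i - ∏ i ∈ s, g i‖ ≤ ∑ i ∈ s, ‖f i - g i‖ := by
  classical
  induction s using Finset.induction_on with
  | empty => simp
  | insert a s ha ih =>
    rw [Finset.prod_insert ha, Finset.prod_insert ha, Finset.sum_insert ha]
    have h1 := ih (fun i hi => hf i (Finset.mem_insert_of_mem hi))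
      (fun i hi => hg i (Finset.mem_insert_of_mem hi))
    have h2 : ‖∏ i ∈ s, f i‖ ≤ 1 := by
      rw [norm_prod]
      exact Finset.prod_le_one (fun _ _ => norm_nonneg _)
        (fun i hi => hf i (Finset.mem_insert_of_mem hi))
    have e : f a * ∏ i ∈ s, f i - g a * ∏ i ∈ s, g i =
        (f a - g a) * ∏ i ∈ s, f i + g a * (∏ i ∈ s, f i - ∏ i ∈ s, g i) := by ring
    rw [e]
    refine (norm_add_le _ _).trans (add_le_add ?_ ?_)
    · rw [norm_mul]
      exact mul_le_of_le_one_right (norm_nonneg _) h2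
    · rw [norm_mul]
      exact (mul_le_of_le_one_left (norm_nonneg _) (hg a (Finset.mem_insert_self _ _))).trans h1

/-- A centred law of variance one has the same characteristic function as the standard normal law
up to an error that is small compared with `t ^ 2`. -/
theorem charFun_sub_gaussian_isLittleO {Ω : Type*} [MeasurableSpace Ω] {P : Measure Ω}
    [IsProbabilityMeasure P] {X : Ω → ℝ} (hX : AEMeasurable X P) (h0 : ∫ ω, X ω ∂P = 0)
    (h1 : ∫ ω, X ω ^ 2 ∂P = 1) :
    (fun t : ℝ => charFun (P.map X) t - Complex.exp (-(t : ℂ) ^ 2 / 2)) =o[𝓝 0]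
      fun t : ℝ => t ^ 2 := by
  have a := taylor_charFun_two hX h0 h1
  have hg : charFun (gaussianReal 0 1) = fun t : ℝ => Complex.exp (-(t : ℂ) ^ 2 / 2) := by
    ext t; rw [charFun_gaussianReal]; congr 1; simp; ring
  have b := taylor_charFun_two (P := gaussianReal 0 1) (X := id) aemeasurable_id
    (by simp) (by
      have := variance_of_integral_eq_zero (μ := gaussianReal 0 1) (X := id) aemeasurable_id
        (by simp)
      simpa using this.symm)
  rw [Measure.map_id, hg] at b
  refine (a.sub b).congr_left fun t => ?_
  ring

/-- For an antitone nonnegative sequence, a bound on the sum of squares bounds every term. -/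
theorem Antitone.mul_sq_le_of_sum_sq_le {β : ℕ → ℝ} (hanti : Antitone β) (hnn : ∀ s, 0 ≤ β s)
    {m s : ℕ} (hms : m ≤ s) {c : ℝ} (hc : ∑ r ∈ Finset.range m, β r ^ 2 ≤ c) :
    m * β s ^ 2 ≤ c := by
  refine le_trans ?_ hc
  have := Finset.card_nsmul_le_sum (Finset.range m) (fun r => β r ^ 2) (β s ^ 2)
    (fun r hr => pow_le_pow_left₀ (hnn s) (hanti ((Finset.mem_range.1 hr).le.trans hms)) 2)
  simpa using this

/-- Think of `χ` as the characteristic function of a centred law of variance one. The product of the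
`χ (β k s * t)` over `s` is the characteristic function at `t` of a linear combination with the
coefficients `β k s` of independent variables with this law. Since these coefficients are
decreasing in `s` with squares of sum one, all but the first `m` of them are small, and the
corresponding part of the combination may be replaced by a Gaussian variable of the same
variance `1 - ∑ s < m, β k s ^ 2`. As `k → ∞` and then `m → ∞`, the assumption `hψ` on the limit
coefficients `b` therefore gives the limit. -/
theorem tendsto_prod_charFun {χ : ℝ → ℂ} (hχ0 : χ 0 = 1) (hχ1 : ∀ t, ‖χ t‖ ≤ 1)
    (hχc : Continuous χ)
    (hχ : (fun t : ℝ => χ t - Complex.exp (-(t : ℂ) ^ 2 / 2)) =o[𝓝 0] fun t : ℝ => t ^ 2)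
    (n : ℕ → ℕ) (β : ℕ → ℕ → ℝ) (hanti : ∀ k, Antitone (β k)) (hnn : ∀ k s, 0 ≤ β k s)
    (hsum : ∀ k, ∑ s ∈ Finset.range (n k), β k s ^ 2 = 1)
    (hzero : ∀ k s, n k ≤ s → β k s = 0) (b : ℕ → ℝ)
    (hβ : ∀ s, Tendsto (fun k => β k s) atTop (𝓝 (b s))) (t : ℝ) (ψ : ℂ)
    (hψ : Tendsto (fun m => (∏ s ∈ Finset.range m, χ (b s * t)) *
      Complex.exp (-((1 - ∑ s ∈ Finset.range m, b s ^ 2) * t ^ 2 / 2 : ℝ))) atTop (𝓝 ψ)) :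
    Tendsto (fun k => ∏ s ∈ Finset.range (n k), χ (β k s * t)) atTop (𝓝 ψ) := by
  rw [Metric.tendsto_atTop]
  intro ε hε
  set c : ℝ := ε / 3 / (t ^ 2 + 1) with hc
  have hcpos : 0 < c := by positivity
  have hct : c * t ^ 2 < ε / 3 := by
    rw [hc, div_mul_eq_mul_div, div_lt_iff₀ (by positivity)]
    nlinarith
  obtain ⟨δ, hδ, hδ'⟩ := Metric.eventually_nhds_iff.1 (hχ.def hcpos)
  obtain ⟨m0, hm0⟩ := Metric.tendsto_atTop.1 hψ (ε / 3) (by positivity)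
  -- `m * β k s ^ 2 ≤ 1` for `s ≥ m`, so that `|β k s * t| < δ` for these `s` if `t ^ 2 < m * δ ^ 2`
  obtain ⟨m1, hm1⟩ := exists_nat_gt (t ^ 2 / δ ^ 2)
  set m := max m0 (max m1 1)
  have hmpos : 0 < m := by omega
  have hm1' : t ^ 2 < m * δ ^ 2 := by
    rw [div_lt_iff₀ (by positivity)] at hm1
    refine hm1.trans_le ?_
    gcongr
    simp [m]
  have hGm := hm0 m (le_max_left _ _)
  set G : ℕ → ℂ := fun k => (∏ s ∈ Finset.range m, χ (β k s * t)) *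
      Complex.exp (-((1 - ∑ s ∈ Finset.range m, β k s ^ 2) * t ^ 2 / 2 : ℝ)) with hG
  have hGlim : Tendsto G atTop (𝓝 ((∏ s ∈ Finset.range m, χ (b s * t)) *
      Complex.exp (-((1 - ∑ s ∈ Finset.range m, b s ^ 2) * t ^ 2 / 2 : ℝ)))) := by
    refine Tendsto.mul ?_ ?_
    · refine tendsto_finsetProd _ fun s _ => ?_
      exact (hχc.tendsto _).comp ((hβ s).mul_const t)
    · refine (Complex.continuous_exp.tendsto _).comp (Tendsto.neg ?_)
      refine (Complex.continuous_ofReal.tendsto _).comp ?_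
      refine Tendsto.div_const (Tendsto.mul_const _ (Tendsto.sub tendsto_const_nhds ?_)) _
      exact tendsto_finsetSum _ fun s _ => (hβ s).pow 2
  obtain ⟨k0, hk0⟩ := Metric.tendsto_atTop.1 hGlim (ε / 3) (by positivity)
  refine ⟨k0, fun k hk => ?_⟩
  -- the replacement by Gaussian factors costs `c * (β k s * t) ^ 2` for every `s ≥ m`
  have key : dist (∏ s ∈ Finset.range (n k), χ (β k s * t)) (G k) ≤ c * t ^ 2 := by
    set M := max (n k) m
    have hsumM : ∑ s ∈ Finset.range M, β k s ^ 2 = 1 := by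
      rw [← hsum k]
      refine (Finset.sum_subset (Finset.range_mono (le_max_left _ _)) fun s _ hs => ?_).symm
      rw [hzero k s (by simpa using hs)]; simp
    have e1 : ∏ s ∈ Finset.range (n k), χ (β k s * t) = ∏ s ∈ Finset.range M, χ (β k s * t) := by
      refine Finset.prod_subset (Finset.range_mono (le_max_left _ _)) fun s _ hs => ?_
      rw [hzero k s (by simpa using hs)]; simpa using hχ0
    have hmM : m ≤ M := le_max_right _ _
    have e2 : G k = ∏ s ∈ Finset.range M, if s < m then χ (β k s * t) else
        Complex.exp (-((β k s * t : ℝ) : ℂ) ^ 2 / 2) := by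
      rw [← Finset.prod_range_mul_prod_Ico _ hmM]
      simp only [hG]
      congr 1
      · refine Finset.prod_congr rfl fun s hs => ?_
        rw [if_pos (Finset.mem_range.1 hs)]
      · rw [Finset.prod_congr rfl fun s hs => if_neg (not_lt.2 (Finset.mem_Ico.1 hs).1),
          ← Complex.exp_sum]
        congr 1
        rw [← hsumM, ← Finset.sum_range_add_sum_Ico _ hmM, add_sub_cancel_left]
        push_cast
        rw [Finset.sum_mul, Finset.sum_div, ← Finset.sum_neg_distrib]
        refine Finset.sum_congr rfl fun s _ => ?_
        ring
    have hle1 : ∀ x : ℝ, ‖Complex.exp (-(x : ℂ) ^ 2 / 2)‖ ≤ 1 := fun x => by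
      rw [Complex.norm_exp]
      have : (-(x : ℂ) ^ 2 / 2) = ((-x ^ 2 / 2 : ℝ) : ℂ) := by push_cast; ring
      rw [this, Complex.ofReal_re, Real.exp_le_one_iff]
      nlinarith [sq_nonneg x]
    rw [e1, e2, dist_eq_norm]
    refine (norm_prod_sub_prod_le_sum _ _ _ (fun _ _ => hχ1 _) (fun s _ => ?_)).trans ?_
    · split_ifs
      · exact hχ1 _
      · exact hle1 _
    · calc _ ≤ ∑ s ∈ Finset.range M, c * t ^ 2 * β k s ^ 2 := by
            refine Finset.sum_le_sum fun s _ => ?_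
            split_ifs with hs
            · simp only [sub_self, norm_zero]; positivity
            · have hb : m * β k s ^ 2 ≤ 1 := by
                refine (hanti k).mul_sq_le_of_sum_sq_le (hnn k) (not_lt.1 hs) ?_
                rw [← hsumM]
                exact Finset.sum_le_sum_of_subset_of_nonneg (Finset.range_mono hmM)
                  fun _ _ _ => sq_nonneg _
              have hd : dist (β k s * t) 0 < δ := by
                rw [Real.dist_0_eq_abs]
                refine abs_lt_of_sq_lt_sq ?_ hδ.le
                have : (m : ℝ) * (β k s * t) ^ 2 < m * δ ^ 2 := by
                  calc (m : ℝ) * (β k s * t) ^ 2 = (m * β k s ^ 2) * t ^ 2 := by ring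
                    _ ≤ 1 * t ^ 2 := by gcongr
                    _ < m * δ ^ 2 := by linarith
                exact lt_of_mul_lt_mul_left this (by positivity)
              refine (hδ' hd).trans (le_of_eq ?_)
              rw [Real.norm_of_nonneg (sq_nonneg _)]; ring
        _ = c * t ^ 2 := by rw [← Finset.mul_sum, hsumM, mul_one]
  calc dist (∏ s ∈ Finset.range (n k), χ (β k s * t)) ψ
      ≤ dist (∏ s ∈ Finset.range (n k), χ (β k s * t)) (G k) + dist (G k) _ + dist _ ψ :=
        dist_triangle4 _ _ _ _
    _ < ε / 3 + ε / 3 + ε / 3 := by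
        gcongr
        · exact key.trans_lt hct
        · exact hk0 k hk
    _ = ε := by ring

theorem norm_charFun_sub_charFun_le {Ω : Type*} [MeasurableSpace Ω] {P : Measure Ω}
    [IsProbabilityMeasure P] {X Y : Ω → ℝ} (hX : AEMeasurable X P) (hY : AEMeasurable Y P)
    (t : ℝ) {ε : ℝ} (hε : 0 ≤ ε) :
    ‖charFun (P.map X) t - charFun (P.map Y) t‖ ≤ |t| * ε + 2 * P.real {ω | ε < |X ω - Y ω|} := by
  have hm : NullMeasurableSet {ω | ε < |X ω - Y ω|} P :=
    nullMeasurableSet_lt aemeasurable_const (hX.sub hY).abs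
  have hn : ∀ x : ℝ, ‖Complex.exp (t * x * Complex.I)‖ = 1 := fun x => by
    rw [← Complex.ofReal_mul, Complex.norm_exp_ofReal_mul_I]
  have hint : ∀ {V : Ω → ℝ}, AEMeasurable V P →
      Integrable (fun ω => Complex.exp (t * V ω * Complex.I)) P := fun {V} hV => by
    refine (integrable_const (1 : ℝ)).mono' ?_ (ae_of_all _ fun ω => (hn _).le)
    exact AEMeasurable.aestronglyMeasurable (by fun_prop)
  have hch : ∀ {V : Ω → ℝ}, AEMeasurable V P →
      charFun (P.map V) t = ∫ ω, Complex.exp (t * V ω * Complex.I) ∂P := fun {V} hV => by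
    rw [charFun_apply_real, integral_map hV]
    exact Measurable.aestronglyMeasurable (by fun_prop)
  rw [hch hX, hch hY, ← integral_sub (hint hX) (hint hY)]
  have hbound : ∀ ω, ‖Complex.exp (t * X ω * Complex.I) - Complex.exp (t * Y ω * Complex.I)‖ ≤
      |t| * ε + {ω | ε < |X ω - Y ω|}.indicator (fun _ => (2 : ℝ)) ω := fun ω => by
    by_cases h : ε < |X ω - Y ω|
    · rw [Set.indicator_of_mem (by exact h)]
      refine (norm_sub_le _ _).trans ?_
      rw [hn, hn]
      nlinarith [abs_nonneg t]
    · rw [Set.indicator_of_notMem (by exact h), add_zero]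
      have e : Complex.exp (t * X ω * Complex.I) - Complex.exp (t * Y ω * Complex.I) =
          Complex.exp (t * Y ω * Complex.I) *
            (Complex.exp (Complex.I * ((t * (X ω - Y ω) : ℝ) : ℂ)) - 1) := by
        rw [mul_sub, ← Complex.exp_add, mul_one]
        congr 2
        push_cast; ring
      rw [e, norm_mul, hn, one_mul]
      refine (Real.norm_exp_I_mul_ofReal_sub_one_le).trans ?_
      rw [Real.norm_eq_abs, abs_mul]
      exact mul_le_mul_of_nonneg_left (not_lt.1 h) (abs_nonneg _)
  refine (norm_integral_le_integral_norm _).trans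
    ((integral_mono ((hint hX).sub (hint hY)).norm ?_ hbound).trans (le_of_eq ?_))
  · exact (integrable_const _).add ((integrable_const _).indicator₀ hm)
  · rw [integral_add (integrable_const _) ((integrable_const _).indicator₀ hm),
      integral_indicator₀ hm]
    simp [mul_comm]

/-- Slutsky's theorem for real random variables on varying probability spaces. -/
theorem MeasureTheory.TendstoInDistribution.of_tendsto_measureReal_sub {Ω : ℕ → Type*}
    [∀ k, MeasurableSpace (Ω k)] {P : (k : ℕ) → Measure (Ω k)} [∀ k, IsProbabilityMeasure (P k)]
    {Ω' : Type*} [MeasurableSpace Ω'] {P' : Measure Ω'} [IsProbabilityMeasure P']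
    {X Y : (k : ℕ) → Ω k → ℝ} {L : Ω' → ℝ} (hX : TendstoInDistribution X atTop L P P')
    (hY : ∀ k, AEMeasurable (Y k) (P k))
    (hXY : ∀ ε > 0, Tendsto (fun k => (P k).real {ω | ε < |Y k ω - X k ω|}) atTop (𝓝 0)) :
    TendstoInDistribution Y atTop L P P' where
  forall_aemeasurable := hY
  aemeasurable_limit := hX.aemeasurable_limit
  tendsto := by
    refine ProbabilityMeasure.tendsto_iff_tendsto_charFun.2 fun t => ?_
    have h1 := ProbabilityMeasure.tendsto_iff_tendsto_charFun.1 hX.tendsto t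
    have h2 : Tendsto (fun k => charFun ((P k).map (Y k)) t - charFun ((P k).map (X k)) t) atTop
        (𝓝 0) := by
      rw [Metric.tendsto_atTop]
      intro ε hε
      set δ := ε / 2 / (|t| + 1)
      have hδ : 0 < δ := by positivity
      have hδ' : |t| * δ < ε / 2 := by
        simp only [δ]
        rw [mul_div_assoc', div_lt_iff₀ (by positivity)]
        nlinarith
      obtain ⟨k0, hk0⟩ := Metric.tendsto_atTop.1 (hXY δ hδ) (ε / 4) (by positivity)
      refine ⟨k0, fun k hk => ?_⟩
      have h3 := hk0 k hk
      rw [Real.dist_0_eq_abs, abs_of_nonneg measureReal_nonneg] at h3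
      rw [dist_zero_right]
      refine (norm_charFun_sub_charFun_le (hY k) (hX.forall_aemeasurable k) t hδ.le).trans_lt ?_
      linarith
    have := h2.add h1
    simpa using this

/-! ### Standardized chi-squared variables and their series -/

/-- A series of independent centred random variables with summable variances converges almost
surely. -/
theorem exists_ae_tendsto_sum_of_summable_variance {Ω : Type*} [MeasurableSpace Ω] {P : Measure Ω}
    [IsProbabilityMeasure P] {X : ℕ → Ω → ℝ} (hX : ∀ s, MemLp (X s) 2 P)
    (h0 : ∀ s, ∫ ω, X s ω ∂P = 0) (hind : iIndepFun X P)
    (hsum : Summable fun s => variance (X s) P) :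
    ∃ S : Ω → ℝ, Measurable S ∧
      ∀ᵐ ω ∂P, Tendsto (fun m => ∑ s ∈ Finset.range m, X s ω) atTop (𝓝 (S ω)) := by
  set Y : ℕ → Ω → ℝ := fun s => (hX s).1.mk (X s) with hYdef
  have hYX : ∀ s, X s =ᵐ[P] Y s := fun s => (hX s).1.ae_eq_mk
  have hYm : ∀ s, StronglyMeasurable (Y s) := fun s => (hX s).1.stronglyMeasurable_mk
  have hY2 : ∀ s, MemLp (Y s) 2 P := fun s => (memLp_congr_ae (hYX s)).1 (hX s)
  have hYind : iIndepFun Y P := hind.congr hYX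
  have hYint : ∀ s, Integrable (Y s) P := fun s => (hY2 s).integrable (by norm_num)
  have hY0 : ∀ s, ∫ ω, Y s ω ∂P = 0 := fun s => by
    rw [← integral_congr_ae (hYX s)]; exact h0 s
  -- the partial sums form a martingale that is bounded in `L²`, hence in `L¹`
  set F := Filtration.natural Y hYm
  set f : ℕ → Ω → ℝ := fun n => ∑ s ∈ Finset.range (n + 1), Y s with hf
  have hadapt : StronglyAdapted F f := fun n => by
    refine Finset.stronglyMeasurable_sum _ fun s hs => ?_
    exact (Filtration.stronglyAdapted_natural hYm s).mono
      (F.mono (Nat.lt_succ_iff.1 (Finset.mem_range.1 hs)))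
  have hfint : ∀ n, Integrable (f n) P := fun n => integrable_finsetSum' _ fun s _ => hYint s
  have hmart : Martingale f F P := by
    refine martingale_nat hadapt hfint fun n => ?_
    have e : f (n + 1) = f n + Y (n + 1) := by
      simp only [hf]; rw [Finset.sum_range_succ]
    have h1 := condExp_add (hfint n) (hYint (n + 1)) (F n)
    have h2 := hYind.condExp_natural_ae_eq_of_lt hYm (Nat.lt_succ_self n)
    rw [e]
    filter_upwards [h1, h2] with ω h1 h2
    rw [h1, Pi.add_apply, condExp_of_stronglyMeasurable (F.le n) (hadapt n) (hfint n), h2, hY0,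
      add_zero]
  set V := ∑' s, variance (X s) P
  have hV : ∀ n, ∫ ω, f n ω ^ 2 ∂P ≤ V := fun n => by
    have e0 : ∫ ω, f n ω ∂P = 0 := by
      simp only [hf, Finset.sum_apply]
      rw [integral_finsetSum _ fun s _ => hYint s]
      exact Finset.sum_eq_zero fun s _ => hY0 s
    have e1 := variance_of_integral_eq_zero (hfint n).aemeasurable e0
    have e2 : variance (f n) P = ∑ s ∈ Finset.range (n + 1), variance (Y s) P :=
      IndepFun.variance_sum (fun s _ => hY2 s)
        fun i _ j _ hij => hYind.indepFun hij
    rw [← e1, e2, Finset.sum_congr rfl fun s _ => (variance_congr (hYX s)).symm]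
    exact hsum.sum_le_tsum _ fun _ _ => variance_nonneg _ _
  have hbdd : ∀ n, eLpNorm (f n) 1 P ≤ ((1 + V).toNNReal : ENNReal) := fun n => by
    rw [eLpNorm_one_eq_lintegral_enorm, ← ofReal_integral_norm_eq_lintegral_enorm (hfint n)]
    refine ENNReal.ofReal_le_ofReal ?_
    have hf2 : Integrable (fun ω => f n ω ^ 2) P :=
      (memLp_finsetSum' _ fun s _ => hY2 s).integrable_sq
    calc ∫ ω, ‖f n ω‖ ∂P ≤ ∫ ω, (1 + f n ω ^ 2) ∂P := by
          refine integral_mono (hfint n).norm ((integrable_const _).add hf2) fun ω => ?_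
          simp only [Real.norm_eq_abs]
          nlinarith [sq_nonneg (|f n ω| - 1), sq_abs (f n ω), abs_nonneg (f n ω)]
      _ ≤ 1 + V := by
          rw [integral_add (integrable_const _) hf2]
          simpa using hV n
  obtain ⟨S, hSm, hconv⟩ := measurable_limit_of_tendsto_metrizable_ae
    (fun n => (hfint n).aemeasurable) (hmart.submartingale.exists_ae_tendsto_of_bdd hbdd)
  refine ⟨S, hSm, ?_⟩
  filter_upwards [hconv, ae_all_iff.2 hYX] with ω hω hXY
  rw [← tendsto_add_atTop_iff_nat 1]
  simpa [hf, hXY] using hω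

section GaussianMoments

/-- The derivative of a function times the moment generating function of a centred normal law. -/
theorem hasDerivAt_mul_exp_sq (p : ℝ → ℝ) (p' v t : ℝ) (hp : HasDerivAt p p' t) :
    HasDerivAt (fun t => p t * Real.exp (v * t ^ 2 / 2))
      ((p' + v * t * p t) * Real.exp (v * t ^ 2 / 2)) t := by
  have h1 : HasDerivAt (fun t : ℝ => v * t ^ 2 / 2) (v * t) t := by
    have := ((hasDerivAt_pow 2 t).const_mul v).div_const 2
    convert! this using 1
    simp; ring
  convert! hp.mul h1.exp using 1
  ring

theorem integral_pow_four_gaussianReal (v : NNReal) :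
    ∫ x, x ^ 4 ∂(gaussianReal 0 v) = 3 * (v : ℝ) ^ 2 := by
  have h := iteratedDeriv_mgf_zero (X := id) (μ := gaussianReal 0 v)
    (by rw [integrableExpSet_id_gaussianReal]; simp) 4
  rw [mgf_id_gaussianReal] at h
  have e0 : (fun t : ℝ => Real.exp (0 * t + v * t ^ 2 / 2)) =
      fun t => 1 * Real.exp (v * t ^ 2 / 2) := by ext t; simp
  have e1 : deriv (fun t : ℝ => 1 * Real.exp (v * t ^ 2 / 2)) =
      fun t => (v * t) * Real.exp (v * t ^ 2 / 2) := by
    ext t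
    rw [(hasDerivAt_mul_exp_sq (fun _ => 1) 0 v t (hasDerivAt_const t 1)).deriv]; ring
  have e2 : deriv (fun t : ℝ => (v * t) * Real.exp (v * t ^ 2 / 2)) =
      fun t => (v + v ^ 2 * t ^ 2) * Real.exp (v * t ^ 2 / 2) := by
    ext t
    rw [(hasDerivAt_mul_exp_sq (fun t => v * t) v v t
      (by simpa using (hasDerivAt_id t).const_mul (v : ℝ))).deriv]; ring
  have e3 : deriv (fun t : ℝ => (v + v ^ 2 * t ^ 2) * Real.exp (v * t ^ 2 / 2)) =
      fun t => (3 * v ^ 2 * t + v ^ 3 * t ^ 3) * Real.exp (v * t ^ 2 / 2) := by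
    ext t
    rw [(hasDerivAt_mul_exp_sq (fun t => v + v ^ 2 * t ^ 2) (v ^ 2 * (2 * t)) v t
      (by simpa using ((hasDerivAt_pow 2 t).const_mul ((v : ℝ) ^ 2)).const_add (v : ℝ))).deriv]
    ring
  have e4 : deriv (fun t : ℝ => (3 * v ^ 2 * t + v ^ 3 * t ^ 3) * Real.exp (v * t ^ 2 / 2)) 0 =
      3 * (v : ℝ) ^ 2 := by
    have hp : HasDerivAt (fun t : ℝ => 3 * (v : ℝ) ^ 2 * t + v ^ 3 * t ^ 3) (3 * (v : ℝ) ^ 2) 0 := by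
      have a := ((hasDerivAt_id (0 : ℝ)).const_mul (3 * (v : ℝ) ^ 2)).add
        ((hasDerivAt_pow 3 (0 : ℝ)).const_mul ((v : ℝ) ^ 3))
      convert! a using 1
      simp
    rw [(hasDerivAt_mul_exp_sq _ _ v 0 hp).deriv]; simp
  simp only [iteratedDeriv_succ, iteratedDeriv_zero] at h
  rw [show ((0 : ℝ)) = 0 from rfl, e0, e1, e2, e3, e4] at h
  simpa using h.symm

theorem integrable_pow_gaussianReal (v : NNReal) (n : ℕ) :
    Integrable (fun x => x ^ n) (gaussianReal 0 v) := by
  have := (memLp_id_gaussianReal (μ := 0) (v := v) n).integrable_norm_pow'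
  refine this.mono' (by fun_prop) (ae_of_all _ fun x => by simp)

theorem integral_sq_gaussianReal (v : NNReal) : ∫ x, x ^ 2 ∂(gaussianReal 0 v) = v := by
  have := variance_of_integral_eq_zero (μ := gaussianReal 0 v) (X := id) aemeasurable_id (by simp)
  simpa using this.symm

end GaussianMoments

/-- The characteristic function of the standardized chi-squared distribution with one degree of
freedom. -/
noncomputable def stdChiSqCharFun : ℝ → ℂ :=
  charFun ((gaussianReal 0 1).map fun x => (x ^ 2 - 1) / √2)

instance : IsProbabilityMeasure ((gaussianReal 0 1).map fun x => (x ^ 2 - 1) / √2) :=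
  Measure.isProbabilityMeasure_map (by fun_prop)

theorem integral_stdChiSq : ∫ x, (x ^ 2 - 1) / √2 ∂(gaussianReal 0 1) = 0 := by
  rw [integral_div, integral_sub (integrable_pow_gaussianReal 1 2) (integrable_const _),
    integral_sq_gaussianReal]
  simp

theorem integral_stdChiSq_sq : ∫ x, ((x ^ 2 - 1) / √2) ^ 2 ∂(gaussianReal 0 1) = 1 := by
  have e : ∀ x : ℝ, ((x ^ 2 - 1) / √2) ^ 2 = (x ^ 4 - 2 * x ^ 2 + 1) / 2 := fun x => by
    rw [div_pow, Real.sq_sqrt (by norm_num)]; ring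
  simp_rw [e]
  have hi : Integrable (fun x : ℝ => x ^ 4 - 2 * x ^ 2) (gaussianReal 0 1) :=
    (integrable_pow_gaussianReal 1 4).sub ((integrable_pow_gaussianReal 1 2).const_mul 2)
  rw [integral_div, integral_add hi (integrable_const _),
    integral_sub (integrable_pow_gaussianReal 1 4) ((integrable_pow_gaussianReal 1 2).const_mul 2),
    integral_const_mul, integral_sq_gaussianReal, integral_pow_four_gaussianReal]
  norm_num

theorem stdChiSqCharFun_isLittleO :
    (fun t : ℝ => stdChiSqCharFun t - Complex.exp (-(t : ℂ) ^ 2 / 2)) =o[𝓝 0]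
      fun t : ℝ => t ^ 2 :=
  charFun_sub_gaussian_isLittleO (by fun_prop) integral_stdChiSq integral_stdChiSq_sq

theorem map_stdChiSq {Ω : Type*} [MeasurableSpace Ω] {P : Measure Ω} {C : Ω → ℝ}
    (hC : HasLaw C chiSquaredOne P) :
    P.map (fun ω => (C ω - 1) / √2) = (gaussianReal 0 1).map fun x => (x ^ 2 - 1) / √2 := by
  have h1 := AEMeasurable.map_map_of_aemeasurable (μ := P) (f := C) (g := fun x : ℝ => (x - 1) / √2)
    (by fun_prop) hC.aemeasurable
  rw [Function.comp_def, hC.map_eq, chiSquaredOne, Measure.map_map (by fun_prop) (by fun_prop)] at h1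
  exact h1.symm

section Limit

variable {Ω' : Type*} [MeasurableSpace Ω'] {P' : Measure Ω'} [IsProbabilityMeasure P']
    {C : ℕ → Ω' → ℝ} {b : ℕ → ℝ}

theorem exists_ae_tendsto_sum_chiSquared (hC : ∀ s, HasLaw (C s) chiSquaredOne P')
    (hCindep : iIndepFun C P') (hb : Summable fun s => b s ^ 2) :
    ∃ S : Ω' → ℝ, Measurable S ∧ ∀ᵐ ω ∂P', Tendsto
      (fun m => ∑ s ∈ Finset.range m, b s * ((C s ω - 1) / √2)) atTop (𝓝 (S ω)) := by
  have hm : ∀ s, AEMeasurable (fun ω => (C s ω - 1) / √2) P' := fun s =>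
    ((hC s).aemeasurable.sub_const 1).div_const _
  have hg2 : MemLp (fun x : ℝ => (x ^ 2 - 1) / √2) 2 (gaussianReal 0 1) := by
    rw [memLp_two_iff_integrable_sq (by fun_prop)]
    exact Integrable.of_integral_ne_zero (by rw [integral_stdChiSq_sq]; norm_num)
  have hid : ∀ s, IdentDistrib (fun ω => (C s ω - 1) / √2) (fun x : ℝ => (x ^ 2 - 1) / √2) P'
      (gaussianReal 0 1) := fun s => ⟨hm s, by fun_prop, map_stdChiSq (hC s)⟩
  have h2 : ∀ s, MemLp (fun ω => (C s ω - 1) / √2) 2 P' := fun s => (hid s).memLp_iff.2 hg2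
  have hvar : ∀ s, variance (fun ω => (C s ω - 1) / √2) P' = 1 := fun s => by
    rw [(hid s).variance_eq, variance_of_integral_eq_zero (by fun_prop) integral_stdChiSq,
      integral_stdChiSq_sq]
  refine exists_ae_tendsto_sum_of_summable_variance (fun s => (h2 s).const_mul (b s))
    (fun s => ?_) (hCindep.comp (fun s x => b s * ((x - 1) / √2)) fun s => by fun_prop) ?_
  · rw [integral_const_mul, (hid s).integral_eq, integral_stdChiSq, mul_zero]
  · simp_rw [variance_const_mul, hvar, mul_one]
    exact hb

/-- The characteristic function of the limit variable, as a limit of characteristic functions of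
finite sums in which the tail of the series is absorbed into the Gaussian summand, so that the
variance of the sum is one throughout. -/
theorem tendsto_charFun_sum_chiSquared_add_gaussian (hC : ∀ s, HasLaw (C s) chiSquaredOne P')
    (hCindep : iIndepFun C P') {Z : Ω' → ℝ} (hZ : HasLaw Z (gaussianReal 0 1) P')
    (hCZ : IndepFun (fun ω s => C s ω) Z P') (hb : Summable fun s => b s ^ 2)
    (hb1 : ∑' s, b s ^ 2 ≤ 1) {S : Ω' → ℝ} (hSm : Measurable S)
    (hS : ∀ᵐ ω ∂P', Tendsto (fun m => ∑ s ∈ Finset.range m, b s * ((C s ω - 1) / √2)) atTop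
      (𝓝 (S ω))) (t : ℝ) :
    Tendsto (fun m => (∏ s ∈ Finset.range m, stdChiSqCharFun (b s * t)) *
      Complex.exp (-((1 - ∑ s ∈ Finset.range m, b s ^ 2) * t ^ 2 / 2 : ℝ))) atTop
      (𝓝 (charFun (P'.map fun ω => S ω + √(1 - ∑' s, b s ^ 2) * Z ω) t)) := by
  have hm : ∀ s, AEMeasurable (fun ω => (C s ω - 1) / √2) P' := fun s =>
    ((hC s).aemeasurable.sub_const 1).div_const _
  have hm' : ∀ s, AEMeasurable (fun ω => b s * ((C s ω - 1) / √2)) P' := fun s =>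
    (hm s).const_mul _
  have hT : TendstoInDistribution (fun m ω => ∑ s ∈ Finset.range m, b s * ((C s ω - 1) / √2) +
      √(1 - ∑ s ∈ Finset.range m, b s ^ 2) * Z ω) atTop
      (fun ω => S ω + √(1 - ∑' s, b s ^ 2) * Z ω) (fun _ => P') P' := by
    refine tendstoInDistribution_of_ae_tendsto (fun m => ?_) ?_ ?_
    · exact (Finset.aemeasurable_fun_sum _ fun s _ => hm' s).add (hZ.aemeasurable.const_mul _)
    · exact hSm.aemeasurable.add (hZ.aemeasurable.const_mul _)
    · filter_upwards [hS] with ω hω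
      refine hω.add (Tendsto.mul_const _ ?_)
      exact (Real.continuous_sqrt.tendsto _).comp
        (tendsto_const_nhds.sub hb.hasSum.tendsto_sum_nat)
  have hlim := ProbabilityMeasure.tendsto_iff_tendsto_charFun.1 hT.tendsto t
  refine hlim.congr fun m => ?_
  have h1 : Measurable fun c : ℕ → ℝ => ∑ s ∈ Finset.range m, b s * ((c s - 1) / √2) := by
    fun_prop
  have h2 : Measurable fun z : ℝ => √(1 - ∑ s ∈ Finset.range m, b s ^ 2) * z := by fun_prop
  have hind : IndepFun (fun ω => ∑ s ∈ Finset.range m, b s * ((C s ω - 1) / √2))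
      (fun ω => √(1 - ∑ s ∈ Finset.range m, b s ^ 2) * Z ω) P' :=
    by have := hCZ.comp h1 h2; exact this
  have hind2 : iIndepFun (fun s ω => b s * ((C s ω - 1) / √2)) P' :=
    hCindep.comp (fun s x => b s * ((x - 1) / √2)) fun s => by fun_prop
  have hle : 0 ≤ 1 - ∑ s ∈ Finset.range m, b s ^ 2 := by
    have := hb.sum_le_tsum (Finset.range m) fun _ _ => sq_nonneg _
    linarith
  simp only [ProbabilityMeasure.coe_mk]
  rw [hind.charFun_map_fun_add_eq_mul (Finset.aemeasurable_fun_sum _ fun s _ => hm' s)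
    (hZ.aemeasurable.const_mul _), Pi.mul_apply,
    (hind2.restrict _).charFun_map_fun_finsetSum_eq_prod fun s _ => hm' s, Finset.prod_apply]
  congr 1
  · refine Finset.prod_congr rfl fun s _ => ?_
    rw [charFun_map_mul_comp (hm s), map_stdChiSq (hC s)]
    rfl
  · rw [charFun_map_mul_comp hZ.aemeasurable, hZ.map_eq, charFun_gaussianReal]
    congr 1
    have : ((√(1 - ∑ s ∈ Finset.range m, b s ^ 2) : ℝ) : ℂ) ^ 2 =
        ((1 - ∑ s ∈ Finset.range m, b s ^ 2 : ℝ) : ℂ) := by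
      rw [← Complex.ofReal_pow, Real.sq_sqrt hle]
    push_cast at this ⊢
    rw [mul_pow, this]
    ring

end Limit

/-! ### Gaussian scores in an eigenbasis of `T V_N T` -/

namespace SplitPlotDesign

variable (D : SplitPlotDesign)

/-- The eigenvalues of `T V_N T`, indexed by the coordinates of the pooled space. -/
noncomputable def lam : D.Idx → ℝ := D.isHermitian_TVT.eigenvalues

/-- The matrix `Oᵀ T`, where the columns of `O` are an orthonormal eigenbasis of `T V_N T`. -/
noncomputable def load : Matrix D.Idx D.Idx ℝ :=
  (D.isHermitian_TVT.eigenvectorUnitary : Matrix D.Idx D.Idx ℝ)ᵀ * D.T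

theorem load_mul_V_mul_transpose : D.load * D.V * D.loadᵀ = Matrix.diagonal D.lam := by
  have h := D.isHermitian_TVT.conjStarAlgAut_star_eigenvectorUnitary
  rw [Unitary.conjStarAlgAut_apply] at h
  have h2 : (D.isHermitian_TVT.eigenvectorUnitary : Matrix D.Idx D.Idx ℝ)ᵀ =
      star (D.isHermitian_TVT.eigenvectorUnitary : Matrix D.Idx D.Idx ℝ) := by
    rw [Matrix.star_eq_conjTranspose, Matrix.conjTranspose_eq_transpose_of_trivial]
  unfold load lam
  rw [Matrix.transpose_mul, Matrix.transpose_transpose, D.T_symm.eq, h2]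
  simp only [star_star, Unitary.coe_star] at h
  simp only [Matrix.mul_assoc] at h ⊢
  rw [h]
  rfl

theorem transpose_load_mul_load : D.loadᵀ * D.load = D.T := by
  unfold load
  rw [Matrix.transpose_mul, Matrix.transpose_transpose, D.T_symm.eq, Matrix.mul_assoc,
    ← Matrix.mul_assoc _ _ D.T]
  have h2 : (D.isHermitian_TVT.eigenvectorUnitary : Matrix D.Idx D.Idx ℝ)ᵀ =
      star (D.isHermitian_TVT.eigenvectorUnitary : Matrix D.Idx D.Idx ℝ) := by
    rw [Matrix.star_eq_conjTranspose, Matrix.conjTranspose_eq_transpose_of_trivial]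
  rw [h2, (Unitary.mem_iff.1 D.isHermitian_TVT.eigenvectorUnitary.2).2, Matrix.one_mul]
  exact D.T_idem

theorem N_pos : 0 < D.N := by
  have : Nonempty (Fin D.a) := ⟨⟨0, D.a_pos⟩⟩
  exact Finset.sum_pos (fun i _ => D.n_pos i) Finset.univ_nonempty

theorem weight_pos (i : Fin D.a) : 0 < (D.N : ℝ) / (D.n i : ℝ) :=
  div_pos (Nat.cast_pos.2 D.N_pos) (Nat.cast_pos.2 (D.n_pos i))

theorem dotProduct_V_mulVec (v : D.Idx → ℝ) : v ⬝ᵥ D.V *ᵥ v =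
    ∑ i, (D.N : ℝ) / (D.n i : ℝ) *
      ((fun t => v ⟨i, t⟩) ⬝ᵥ D.cov i *ᵥ (fun t => v ⟨i, t⟩)) := by
  simp only [dotProduct, Matrix.mulVec, Fintype.sum_sigma, V]
  refine Finset.sum_congr rfl fun i _ => ?_
  rw [Finset.mul_sum]
  refine Finset.sum_congr rfl fun t _ => ?_
  rw [Finset.sum_eq_single i (fun j _ hj => Finset.sum_eq_zero fun t' _ => by
    rw [Matrix.blockDiagonal'_apply_ne _ _ _ (Ne.symm hj), zero_mul]) (by simp)]
  simp only [Matrix.blockDiagonal'_apply_eq, Matrix.smul_apply, smul_eq_mul, Finset.mul_sum]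
  refine Finset.sum_congr rfl fun t' _ => ?_
  ring

theorem dotProduct_V_nonneg (v : D.Idx → ℝ) : 0 ≤ v ⬝ᵥ D.V *ᵥ v := by
  rw [dotProduct_V_mulVec]
  refine Finset.sum_nonneg fun i _ => mul_nonneg (D.weight_pos i).le ?_
  simpa using (D.cov_posDef i).posSemidef.dotProduct_mulVec_nonneg (fun t => v ⟨i, t⟩)

theorem dotProduct_V_pos {v : D.Idx → ℝ} (hv : v ≠ 0) : 0 < v ⬝ᵥ D.V *ᵥ v := by
  obtain ⟨⟨i, t⟩, hit⟩ := Function.ne_iff.1 hv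
  rw [dotProduct_V_mulVec]
  refine Finset.sum_pos' (fun i _ => mul_nonneg (D.weight_pos i).le ?_)
    ⟨i, Finset.mem_univ _, mul_pos (D.weight_pos i) ?_⟩
  · simpa using (D.cov_posDef i).posSemidef.dotProduct_mulVec_nonneg (fun t => v ⟨i, t⟩)
  · have hne : (fun t => v ⟨i, t⟩) ≠ 0 := Function.ne_iff.2 ⟨t, hit⟩
    simpa using (D.cov_posDef i).dotProduct_mulVec_pos hne

theorem load_row (s s' : D.Idx) : ∑ p, ∑ q, D.load s p * D.load s' q * D.V p q =
    if s = s' then D.lam s else 0 := by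
  have h := congrFun (congrFun D.load_mul_V_mul_transpose s) s'
  rw [Matrix.diagonal_apply] at h
  rw [← h, Matrix.mul_apply, Finset.sum_comm]
  refine Finset.sum_congr rfl fun q _ => ?_
  rw [Matrix.mul_apply, Finset.sum_mul, Matrix.transpose_apply]
  refine Finset.sum_congr rfl fun p _ => ?_
  ring

theorem lam_eq (s : D.Idx) : D.lam s = D.load s ⬝ᵥ D.V *ᵥ D.load s := by
  have h := D.load_row s s
  rw [if_pos rfl] at h
  rw [← h]
  simp only [dotProduct, Matrix.mulVec, Finset.mul_sum]
  refine Finset.sum_congr rfl fun p _ => Finset.sum_congr rfl fun q _ => ?_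
  ring

theorem lam_nonneg (s : D.Idx) : 0 ≤ D.lam s := by
  rw [lam_eq]; exact D.dotProduct_V_nonneg _

theorem sum_lam_sq_pos (hT : D.T ≠ 0) : 0 < ∑ s, D.lam s ^ 2 := by
  have h : ∃ s, D.load s ≠ 0 := by
    by_contra! h
    apply hT
    rw [← transpose_load_mul_load, show D.load = 0 from funext h, Matrix.mul_zero]
  obtain ⟨s, hs⟩ := h
  refine Finset.sum_pos' (fun _ _ => sq_nonneg _) ⟨s, Finset.mem_univ _, pow_pos ?_ 2⟩
  rw [lam_eq]
  exact D.dotProduct_V_pos hs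

/-- Coefficients of a linear combination of the observations within every group. -/
abbrev Weights : Type := (i : Fin D.a) → Fin (D.n i) → ℝ

/-- The pooled vector whose block `i` is the combination of the centred observations of group `i`
with the coefficients `c i`. -/
noncomputable def combo (c : D.Weights) (x : D.Data) : D.Idx → ℝ :=
  fun p => ∑ j, c p.1 j * (x p.1 j p.2 - D.mean p.1 p.2)

/-- The coordinates of `T z` in the eigenbasis of `T V_N T`, for the pooled vector
`z = D.combo c x`. -/
noncomputable def score (c : D.Weights) (x : D.Data) : D.Idx → ℝ := D.load *ᵥ D.combo c x

theorem combo_dotProduct_combo (c c' : D.Weights) (x : D.Data) :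
    D.combo c x ⬝ᵥ D.T *ᵥ D.combo c' x = ∑ s, D.score c x s * D.score c' x s := by
  rw [← transpose_load_mul_load, ← Matrix.mulVec_mulVec, Matrix.dotProduct_mulVec,
    Matrix.vecMul_transpose]
  rfl

/-- The linear form on the centred data whose value is a coordinate of the score. -/
noncomputable def scoreCLM (c : D.Weights) (s : D.Idx) :
    ((q : Σ i : Fin D.a, Fin (D.n i)) → EuclideanSpace ℝ (Fin (D.d q.1))) →L[ℝ] ℝ :=
  ∑ p : D.Idx, D.load s p • ∑ j : Fin (D.n p.1), c p.1 j •
    ((EuclideanSpace.proj p.2 : EuclideanSpace ℝ (Fin (D.d p.1)) →L[ℝ] ℝ).comp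
      (ContinuousLinearMap.proj (⟨p.1, j⟩ : Σ i : Fin D.a, Fin (D.n i)) :
        ((q : Σ i : Fin D.a, Fin (D.n i)) → EuclideanSpace ℝ (Fin (D.d q.1))) →L[ℝ]
          EuclideanSpace ℝ (Fin (D.d p.1))))

theorem scoreCLM_apply (c : D.Weights) (s : D.Idx) (x : D.Data) :
    D.scoreCLM c s (fun q => x q.1 q.2 - D.mean q.1) = D.score c x s := by
  simp [scoreCLM, score, combo, Matrix.mulVec, dotProduct]

theorem measurable_coord (i : Fin D.a) (t : Fin (D.d i)) :
    Measurable fun x : EuclideanSpace ℝ (Fin (D.d i)) => x t - D.mean i t := by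
  fun_prop

section Random

variable {Ω : Type*} [MeasurableSpace Ω] {P : Measure Ω}
  {X : (i : Fin D.a) → Fin (D.n i) → Ω → EuclideanSpace ℝ (Fin (D.d i))}

variable {D} in
theorem IsSample.hasGaussianLaw_sub (hX : D.IsSample P X) (i : Fin D.a) (j : Fin (D.n i)) :
    HasGaussianLaw (fun ω => X i j ω - D.mean i) P where
  isGaussian_map := by
    have h := AEMeasurable.map_map_of_aemeasurable (μ := P) (f := X i j)
      (g := fun x => x - D.mean i) (by fun_prop) (hX.hasLaw i j).aemeasurable
    rw [Function.comp_def, (hX.hasLaw i j).map_eq] at h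
    rw [← h]
    infer_instance

variable {D} in
theorem IsSample.hasGaussianLaw_centred (hX : D.IsSample P X) :
    HasGaussianLaw (fun ω (q : Σ i : Fin D.a, Fin (D.n i)) => X q.1 q.2 ω - D.mean q.1) P := by
  refine iIndepFun.hasGaussianLaw (fun q => hX.hasGaussianLaw_sub q.1 q.2) ?_
  exact hX.indep.comp (fun q x => x - D.mean q.1) fun q => by fun_prop

variable {D} in
theorem IsSample.hasGaussianLaw_score (hX : D.IsSample P X) {κ : Type*} [Fintype κ]
    (c : κ → D.Weights) (s : κ → D.Idx) :
    HasGaussianLaw (fun ω k => D.score (c k) (fun i j => X i j ω) (s k)) P := by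
  have h := hX.hasGaussianLaw_centred.map_fun
    (ContinuousLinearMap.pi fun k => D.scoreCLM (c k) (s k))
  refine h.congr (ae_of_all _ fun ω => ?_)
  ext k
  exact D.scoreCLM_apply (c k) (s k) fun i j => X i j ω

variable {D} in
theorem IsSample.hasGaussianLaw_score_single (hX : D.IsSample P X) (c : D.Weights) (s : D.Idx) :
    HasGaussianLaw (fun ω => D.score c (fun i j => X i j ω) s) P :=
  (hX.hasGaussianLaw_score (fun _ : Unit => c) (fun _ => s)).eval ()

variable {D} in
theorem IsSample.memLp_coord (hX : D.IsSample P X) (i : Fin D.a) (j : Fin (D.n i))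
    (t : Fin (D.d i)) : MemLp (fun ω => X i j ω t - D.mean i t) 2 P := by
  have := ((hX.hasGaussianLaw_sub i j).map_fun
    (EuclideanSpace.proj t : EuclideanSpace ℝ (Fin (D.d i)) →L[ℝ] ℝ)).memLp_two
  simpa using this

variable {D} in
theorem IsSample.covariance_coord (hX : D.IsSample P X) (i : Fin D.a) (j j' : Fin (D.n i))
    (t t' : Fin (D.d i)) :
    cov[fun ω => X i j ω t - D.mean i t, fun ω => X i j' ω t' - D.mean i t'; P] =
      if j = j' then D.cov i t t' else 0 := by
  have := hX.indep.isProbabilityMeasure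
  split_ifs with h
  · subst h
    have hc := covariance_map_fun (μ := P) (Z := X i j) (X := fun x => x t - D.mean i t)
      (Y := fun x => x t' - D.mean i t') (by fun_prop) (by fun_prop)
      (hX.hasLaw i j).aemeasurable
    rw [← hc, (hX.hasLaw i j).map_eq]
    have hint : ∀ t, Integrable (fun x : EuclideanSpace ℝ (Fin (D.d i)) => x t)
        (multivariateGaussian (D.mean i) (D.cov i)) := fun t =>
      ((IsGaussian.hasGaussianLaw_id (μ := multivariateGaussian (D.mean i) (D.cov i))).map_fun
        (EuclideanSpace.proj t : EuclideanSpace ℝ (Fin (D.d i)) →L[ℝ] ℝ)).integrable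
    rw [covariance_sub_const_left (hint t), covariance_sub_const_right (hint t'),
      covariance_eval_multivariateGaussian (D.cov_posDef i).posSemidef]
  · have hne : (⟨i, j⟩ : Σ i : Fin D.a, Fin (D.n i)) ≠ ⟨i, j'⟩ := fun e => h (by simpa using e)
    refine IndepFun.covariance_eq_zero ?_ (hX.memLp_coord i j t) (hX.memLp_coord i j' t')
    exact (hX.indep.indepFun hne).comp (D.measurable_coord i t) (D.measurable_coord i t')

variable {D} in
theorem IsSample.covariance_coord_of_ne (hX : D.IsSample P X) {i i' : Fin D.a} (hi : i ≠ i')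
    (j : Fin (D.n i)) (j' : Fin (D.n i')) (t : Fin (D.d i)) (t' : Fin (D.d i')) :
    cov[fun ω => X i j ω t - D.mean i t, fun ω => X i' j' ω t' - D.mean i' t'; P] = 0 := by
  have := hX.indep.isProbabilityMeasure
  have hne : (⟨i, j⟩ : Σ i : Fin D.a, Fin (D.n i)) ≠ ⟨i', j'⟩ := fun e => hi (by
    simpa using congrArg Sigma.fst e)
  refine IndepFun.covariance_eq_zero ?_ (hX.memLp_coord i j t) (hX.memLp_coord i' j' t')
  exact (hX.indep.indepFun hne).comp (D.measurable_coord i t) (D.measurable_coord i' t')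

variable {D} in
theorem IsSample.covariance_combo (hX : D.IsSample P X) {c c' : D.Weights} {r : ℝ}
    (hc : ∀ i, ∑ j, c i j * c' i j = r * ((D.N : ℝ) / (D.n i : ℝ))) (p q : D.Idx) :
    cov[fun ω => D.combo c (fun i j => X i j ω) p, fun ω => D.combo c' (fun i j => X i j ω) q; P] =
      r * D.V p q := by
  have := hX.indep.isProbabilityMeasure
  obtain ⟨i, t⟩ := p
  obtain ⟨i', t'⟩ := q
  simp only [combo]
  rw [covariance_fun_sum_fun_sum (fun j => (hX.memLp_coord i j t).const_mul _)
    (fun j => (hX.memLp_coord i' j t').const_mul _)]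
  simp_rw [covariance_const_mul_left, covariance_const_mul_right]
  by_cases h : i = i'
  · subst h
    simp_rw [hX.covariance_coord, V, Matrix.blockDiagonal'_apply_eq, Matrix.smul_apply,
      smul_eq_mul, ← mul_assoc, ← hc, Finset.sum_mul, mul_ite, mul_zero]
    refine Finset.sum_congr rfl fun j _ => ?_
    rw [Finset.sum_ite_eq, if_pos (Finset.mem_univ _)]
  · simp_rw [hX.covariance_coord_of_ne h, V, Matrix.blockDiagonal'_apply_ne _ _ _ h]
    simp

variable {D} in
theorem IsSample.memLp_combo (hX : D.IsSample P X) (c : D.Weights) (p : D.Idx) :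
    MemLp (fun ω => D.combo c (fun i j => X i j ω) p) 2 P :=
  memLp_finsetSum _ fun j _ => (hX.memLp_coord p.1 j p.2).const_mul _

variable {D} in
/-- Scores of combinations with orthogonal coefficients are uncorrelated, and so are different
coordinates of scores of the same combination. -/
theorem IsSample.covariance_score (hX : D.IsSample P X) {c c' : D.Weights} {r : ℝ}
    (hc : ∀ i, ∑ j, c i j * c' i j = r * ((D.N : ℝ) / (D.n i : ℝ))) (s s' : D.Idx) :
    cov[fun ω => D.score c (fun i j => X i j ω) s, fun ω => D.score c' (fun i j => X i j ω) s'; P] =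
      r * if s = s' then D.lam s else 0 := by
  have := hX.indep.isProbabilityMeasure
  simp only [score, Matrix.mulVec, dotProduct]
  rw [covariance_fun_sum_fun_sum (fun p => (hX.memLp_combo c p).const_mul _)
    (fun p => (hX.memLp_combo c' p).const_mul _)]
  simp_rw [covariance_const_mul_left, covariance_const_mul_right, hX.covariance_combo hc,
    ← D.load_row s s', Finset.mul_sum]
  refine Finset.sum_congr rfl fun p _ => Finset.sum_congr rfl fun q _ => ?_
  ring

variable {D} in
theorem IsSample.integral_score (hX : D.IsSample P X) (c : D.Weights) (s : D.Idx) :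
    ∫ ω, D.score c (fun i j => X i j ω) s ∂P = 0 := by
  have := hX.indep.isProbabilityMeasure
  have h0 : ∀ i j t, ∫ ω, (X i j ω t - D.mean i t) ∂P = 0 := fun i j t => by
    have h1 := (EuclideanSpace.proj t : EuclideanSpace ℝ (Fin (D.d i)) →L[ℝ] ℝ).integral_comp_comm
      (hX.hasGaussianLaw_sub i j).integrable
    have hi : Integrable (X i j) P := by
      have : HasGaussianLaw (X i j) P := (hX.hasLaw i j).hasGaussianLaw
      exact this.integrable
    have h2 : ∫ ω, X i j ω ∂P = D.mean i := by
      have := (hX.hasLaw i j).integral_eq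
      rw [this, integral_id_multivariateGaussian]
    rw [integral_sub hi (integrable_const _), h2] at h1
    simpa using h1
  have hint : ∀ p : D.Idx, Integrable (fun ω => D.combo c (fun i j => X i j ω) p) P := fun p =>
    (hX.memLp_combo c p).integrable (by norm_num)
  simp only [score, Matrix.mulVec, dotProduct]
  rw [integral_finsetSum _ fun p _ => (hint p).const_mul _]
  refine Finset.sum_eq_zero fun p _ => ?_
  rw [integral_const_mul]
  simp only [combo]
  rw [integral_finsetSum _ fun j _ =>
    ((hX.memLp_coord p.1 j p.2).integrable (by norm_num)).const_mul _]
  simp [integral_const_mul, h0]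

variable {D} in
theorem IsSample.hasLaw_score (hX : D.IsSample P X) {c : D.Weights}
    (hc : ∀ i, ∑ j, c i j * c i j = (D.N : ℝ) / (D.n i : ℝ)) (s : D.Idx) :
    HasLaw (fun ω => D.score c (fun i j => X i j ω) s) (gaussianReal 0 (D.lam s).toNNReal) P where
  aemeasurable := (hX.hasGaussianLaw_score_single c s).aemeasurable
  map_eq := by
    rw [(hX.hasGaussianLaw_score_single c s).map_eq_gaussianReal, hX.integral_score,
      ← covariance_self (hX.hasGaussianLaw_score_single c s).aemeasurable,
      hX.covariance_score (r := 1) (by simpa using hc)]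
    simp

end Random

end SplitPlotDesign

/-! ### Independence and moments of scores -/

section FourthMoment

variable {Ω : Type*} [MeasurableSpace Ω] {P : Measure Ω} [IsProbabilityMeasure P]

theorem integrable_pow_of_integrable_pow_four {X : Ω → ℝ} (hm : AEMeasurable X P)
    (h4 : Integrable (fun ω => X ω ^ 4) P) {k : ℕ} (hk : k ≤ 4) :
    Integrable (fun ω => X ω ^ k) P := by
  refine ((integrable_const (1 : ℝ)).add h4).mono' (hm.pow_const k).aestronglyMeasurable
    (ae_of_all _ fun ω => ?_)
  rw [Real.norm_eq_abs, abs_pow, Pi.add_apply]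
  have h0 : X ω ^ 4 = |X ω| ^ 4 := by rw [← abs_pow, abs_of_nonneg (by positivity)]
  rw [h0]
  rcases le_total |X ω| 1 with h | h
  · have := pow_le_one₀ (n := k) (abs_nonneg (X ω)) h
    have : 0 ≤ |X ω| ^ 4 := by positivity
    linarith
  · have := pow_le_pow_right₀ h hk
    linarith

/-- The bound `E η⁴ ≤ 9 (E η²)²` passes from independent centred random variables to their sums.
The constant `9` is the kurtosis of a product of two independent centred normal variables. -/
theorem moments_sum_of_iIndepFun {ι : Type*} {η : ι → Ω → ℝ} {v : ι → ℝ}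
    (hm : ∀ s, AEMeasurable (η s) P) (hind : iIndepFun η P)
    (h4 : ∀ s, Integrable (fun ω => η s ω ^ 4) P) (e1 : ∀ s, ∫ ω, η s ω ∂P = 0)
    (e2 : ∀ s, ∫ ω, η s ω ^ 2 ∂P = v s) (e4 : ∀ s, ∫ ω, η s ω ^ 4 ∂P ≤ 9 * v s ^ 2)
    (F : Finset ι) :
    Integrable (fun ω => (∑ s ∈ F, η s ω) ^ 4) P ∧ ∫ ω, ∑ s ∈ F, η s ω ∂P = 0 ∧
      ∫ ω, (∑ s ∈ F, η s ω) ^ 2 ∂P = ∑ s ∈ F, v s ∧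
      ∫ ω, (∑ s ∈ F, η s ω) ^ 4 ∂P ≤ 9 * (∑ s ∈ F, v s) ^ 2 := by
  classical
  induction F using Finset.induction_on with
  | empty => simp
  | insert a F ha ih =>
    obtain ⟨i4, j1, j2, j4⟩ := ih
    have hSm : AEMeasurable (fun ω => ∑ s ∈ F, η s ω) P :=
      Finset.aemeasurable_fun_sum _ fun s _ => hm s
    have hind' : IndepFun (fun ω => ∑ s ∈ F, η s ω) (η a) P := by
      have := hind.indepFun_finsetSum_of_notMem₀ hm ha
      convert this using 1
      ext ω; simp
    simp_rw [Finset.sum_insert ha]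
    set S : Ω → ℝ := fun ω => ∑ s ∈ F, η s ω with hS
    change Integrable (fun ω => (η a ω + S ω) ^ 4) P ∧ ∫ ω, (η a ω + S ω) ∂P = 0 ∧
      ∫ ω, (η a ω + S ω) ^ 2 ∂P = v a + ∑ s ∈ F, v s ∧
      ∫ ω, (η a ω + S ω) ^ 4 ∂P ≤ 9 * (v a + ∑ s ∈ F, v s) ^ 2
    have iS : ∀ {k}, k ≤ 4 → Integrable (fun ω => S ω ^ k) P := fun hk =>
      integrable_pow_of_integrable_pow_four hSm i4 hk
    have iη : ∀ {k}, k ≤ 4 → Integrable (fun ω => η a ω ^ k) P := fun hk =>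
      integrable_pow_of_integrable_pow_four (hm a) (h4 a) hk
    have hpow : ∀ k l : ℕ, IndepFun (fun ω => S ω ^ k) (fun ω => η a ω ^ l) P := fun k l =>
      hind'.comp (measurable_id.pow_const k) (measurable_id.pow_const l)
    have iSη : ∀ {k l}, k ≤ 4 → l ≤ 4 → Integrable (fun ω => S ω ^ k * η a ω ^ l) P :=
      fun {k l} hk hl => (hpow k l).integrable_mul (iS hk) (iη hl)
    have eSη : ∀ {k l}, k ≤ 4 → l ≤ 4 → ∫ ω, S ω ^ k * η a ω ^ l ∂P =
        (∫ ω, S ω ^ k ∂P) * ∫ ω, η a ω ^ l ∂P := fun {k l} hk hl =>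
      (hpow k l).integral_fun_mul_eq_mul_integral (iS hk).1 (iη hl).1
    have iS1 : Integrable S P := by simpa using iS (k := 1) (by norm_num)
    have iη1 : Integrable (η a) P := by simpa using iη (k := 1) (by norm_num)
    have m1 : ∫ ω, S ω ^ 1 ∂P = 0 := by simpa using j1
    have n1 : ∫ ω, η a ω ^ 1 ∂P = 0 := by simpa using e1 a
    have hv : 0 ≤ v a := by rw [← e2 a]; exact integral_nonneg fun ω => sq_nonneg _
    have hV : 0 ≤ ∑ s ∈ F, v s := by
      rw [← j2]; exact integral_nonneg fun ω => sq_nonneg _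
    have x4 : ∀ ω, (η a ω + S ω) ^ 4 = η a ω ^ 4 + 4 * (S ω ^ 1 * η a ω ^ 3) +
        6 * (S ω ^ 2 * η a ω ^ 2) + 4 * (S ω ^ 3 * η a ω ^ 1) + S ω ^ 4 := fun ω => by ring
    have x2 : ∀ ω, (η a ω + S ω) ^ 2 = η a ω ^ 2 + 2 * (S ω ^ 1 * η a ω ^ 1) + S ω ^ 2 :=
      fun ω => by ring
    have a1 := (iSη (k := 1) (l := 3) (by norm_num) (by norm_num)).const_mul 4
    have a2 := (iSη (k := 2) (l := 2) (by norm_num) (by norm_num)).const_mul 6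
    have a3 := (iSη (k := 3) (l := 1) (by norm_num) (by norm_num)).const_mul 4
    have a4 := (iSη (k := 1) (l := 1) (by norm_num) (by norm_num)).const_mul 2
    have b1 := (h4 a).add a1
    have b2 := b1.add a2
    have b3 := b2.add a3
    have b4 := (iη (k := 2) (by norm_num)).add a4
    refine ⟨?_, ?_, ?_, ?_⟩
    · simp_rw [x4]
      exact b3.add i4
    · rw [integral_add iη1 iS1, e1, j1, add_zero]
    · simp_rw [x2]
      rw [integral_add (by exact b4) (iS (by norm_num)), integral_add (iη (by norm_num)) a4,
        integral_const_mul, eSη (by norm_num) (by norm_num), m1, e2, j2]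
      ring
    · simp_rw [x4]
      rw [integral_add (by exact b3) i4, integral_add (by exact b2) a3,
        integral_add (by exact b1) a2, integral_add (h4 a) a1, integral_const_mul,
        integral_const_mul, integral_const_mul, eSη (by norm_num) (by norm_num),
        eSη (by norm_num) (by norm_num), eSη (by norm_num) (by norm_num), m1, n1, e2, j2]
      have := e4 a
      nlinarith [mul_nonneg hv hV]

end FourthMoment

namespace SplitPlotDesign

variable {D : SplitPlotDesign} {Ω : Type*} [MeasurableSpace Ω] {P : Measure Ω}
  {X : (i : Fin D.a) → Fin (D.n i) → Ω → EuclideanSpace ℝ (Fin (D.d i))}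

theorem IsSample.isProbabilityMeasure (hX : D.IsSample P X) : IsProbabilityMeasure P :=
  hX.indep.isProbabilityMeasure

/-- Scores of combinations with mutually orthogonal coefficients are independent. -/
theorem IsSample.indepFun_score (hX : D.IsSample P X) {κ κ' : Type*} [Fintype κ] [Fintype κ']
    {c : κ → D.Weights} {c' : κ' → D.Weights} (hc : ∀ k k' i, ∑ j, c k i j * c' k' i j = 0) :
    IndepFun (fun ω (q : κ × D.Idx) => D.score (c q.1) (fun i j => X i j ω) q.2)
      (fun ω (q : κ' × D.Idx) => D.score (c' q.1) (fun i j => X i j ω) q.2) P := by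
  refine HasGaussianLaw.indepFun_of_covariance_eval
    (X := fun (q : κ × D.Idx) ω => D.score (c q.1) (fun i j => X i j ω) q.2)
    (Y := fun (q : κ' × D.Idx) ω => D.score (c' q.1) (fun i j => X i j ω) q.2) ?_ fun q q' => ?_
  · have h := (hX.hasGaussianLaw_score (κ := (κ × D.Idx) ⊕ (κ' × D.Idx))
      (Sum.elim (fun q => c q.1) (fun q => c' q.1)) (Sum.elim (fun q => q.2) (fun q => q.2))).map_fun
      ((ContinuousLinearMap.pi fun q => ContinuousLinearMap.proj (Sum.inl q)).prod
        (ContinuousLinearMap.pi fun q => ContinuousLinearMap.proj (Sum.inr q)))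
    exact h.congr (ae_of_all _ fun ω => rfl)
  · rw [hX.covariance_score (r := 0) (by simpa using hc q.1 q'.1), zero_mul]

/-- Several scores have independent coordinates (each coordinate being a vector indexed by the
scores) if the inner products of their coefficients in group `i` are proportional to `N / n i`. -/
theorem IsSample.iIndepFun_score (hX : D.IsSample P X) {κ : Type*} [Fintype κ]
    {c : κ → D.Weights} {r : κ → κ → ℝ}
    (hc : ∀ k k' i, ∑ j, c k i j * c k' i j = r k k' * ((D.N : ℝ) / (D.n i : ℝ))) :
    iIndepFun (fun (s : D.Idx) ω (k : κ) => D.score (c k) (fun i j => X i j ω) s) P := by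
  refine HasGaussianLaw.iIndepFun_of_covariance_eval
    (X := fun (s : D.Idx) (k : κ) ω => D.score (c k) (fun i j => X i j ω) s) ?_
    fun s s' hs k k' => ?_
  · have h := (hX.hasGaussianLaw_score (κ := D.Idx × κ) (fun q => c q.2) (fun q => q.1)).map_fun
      (ContinuousLinearMap.pi fun s => ContinuousLinearMap.pi fun k =>
        ContinuousLinearMap.proj (s, k) : (D.Idx × κ → ℝ) →L[ℝ] (D.Idx → κ → ℝ))
    exact h.congr (ae_of_all _ fun ω => rfl)
  · rw [hX.covariance_score (hc k k'), if_neg hs, mul_zero]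

/-- The coefficients `c` are normalized so that `D.combo c X` has covariance matrix `V_N`. -/
def IsUnitWeights (c : D.Weights) : Prop := ∀ i, ∑ j, c i j * c i j = (D.N : ℝ) / (D.n i : ℝ)

theorem IsSample.aemeasurable_score (hX : D.IsSample P X) (c : D.Weights) (s : D.Idx) :
    AEMeasurable (fun ω => D.score c (fun i j => X i j ω) s) P :=
  (hX.hasGaussianLaw_score_single c s).aemeasurable

section Moments

variable {c : D.Weights}

theorem IsSample.integral_comp_score (hX : D.IsSample P X) (hc : IsUnitWeights c) (s : D.Idx)
    {E : Type*} [NormedAddCommGroup E] [NormedSpace ℝ E] {f : ℝ → E}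
    (hf : AEStronglyMeasurable f (gaussianReal 0 (D.lam s).toNNReal)) :
    ∫ ω, f (D.score c (fun i j => X i j ω) s) ∂P =
      ∫ x, f x ∂(gaussianReal 0 (D.lam s).toNNReal) :=
  (hX.hasLaw_score hc s).integral_comp hf

theorem IsSample.integral_score_sq (hX : D.IsSample P X) (hc : IsUnitWeights c) (s : D.Idx) :
    ∫ ω, D.score c (fun i j => X i j ω) s ^ 2 ∂P = D.lam s := by
  rw [hX.integral_comp_score hc s (f := fun x => x ^ 2) (by fun_prop), integral_sq_gaussianReal,
    Real.coe_toNNReal _ (D.lam_nonneg s)]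

theorem IsSample.integral_score_pow_four (hX : D.IsSample P X) (hc : IsUnitWeights c)
    (s : D.Idx) : ∫ ω, D.score c (fun i j => X i j ω) s ^ 4 ∂P = 3 * D.lam s ^ 2 := by
  rw [hX.integral_comp_score hc s (f := fun x => x ^ 4) (by fun_prop),
    integral_pow_four_gaussianReal, Real.coe_toNNReal _ (D.lam_nonneg s)]

theorem IsSample.integrable_score_pow (hX : D.IsSample P X) (hc : IsUnitWeights c) (s : D.Idx)
    (k : ℕ) : Integrable (fun ω => D.score c (fun i j => X i j ω) s ^ k) P := by
  have h := integrable_pow_gaussianReal (D.lam s).toNNReal k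
  rw [← (hX.hasLaw_score hc s).map_eq] at h
  exact h.comp_aemeasurable (hX.aemeasurable_score c s)

theorem IsSample.memLp_score_sq (hX : D.IsSample P X) (hc : IsUnitWeights c) (s : D.Idx) :
    MemLp (fun ω => D.score c (fun i j => X i j ω) s ^ 2) 2 P := by
  rw [memLp_two_iff_integrable_sq ((hX.aemeasurable_score c s).pow_const 2).aestronglyMeasurable]
  simp_rw [← pow_mul]
  exact hX.integrable_score_pow hc s _

theorem IsSample.memLp_quadratic (hX : D.IsSample P X) (hc : IsUnitWeights c) :
    MemLp (fun ω => ∑ s, D.score c (fun i j => X i j ω) s ^ 2) 2 P :=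
  memLp_finsetSum _ fun s _ => hX.memLp_score_sq hc s

theorem IsSample.integral_quadratic (hX : D.IsSample P X) (hc : IsUnitWeights c) :
    ∫ ω, ∑ s, D.score c (fun i j => X i j ω) s ^ 2 ∂P = ∑ s, D.lam s := by
  rw [integral_finsetSum _ fun s _ => hX.integrable_score_pow hc s 2]
  simp_rw [hX.integral_score_sq hc]

theorem IsSample.iIndepFun_score_single (hX : D.IsSample P X) (hc : IsUnitWeights c) :
    iIndepFun (fun s ω => D.score c (fun i j => X i j ω) s) P := by
  have h := hX.iIndepFun_score (κ := Unit) (c := fun _ => c) (r := fun _ _ => 1)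
    (fun _ _ i => by simpa using hc i)
  exact h.comp (fun s x => x ()) fun s => measurable_pi_apply _

theorem IsSample.variance_quadratic (hX : D.IsSample P X) (hc : IsUnitWeights c) :
    variance (fun ω => ∑ s, D.score c (fun i j => X i j ω) s ^ 2) P = 2 * ∑ s, D.lam s ^ 2 := by
  have := hX.isProbabilityMeasure
  have h := IndepFun.variance_sum (μ := P) (s := Finset.univ)
    (X := fun s ω => D.score c (fun i j => X i j ω) s ^ 2)
    (fun s _ => hX.memLp_score_sq hc s) fun s _ s' _ hs =>
      ((hX.iIndepFun_score_single hc).indepFun hs).comp (measurable_id.pow_const 2)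
        (measurable_id.pow_const 2)
  have e : (fun ω => ∑ s, D.score c (fun i j => X i j ω) s ^ 2) =
      ∑ s, fun ω => D.score c (fun i j => X i j ω) s ^ 2 := by ext ω; simp
  rw [e, h, Finset.mul_sum]
  refine Finset.sum_congr rfl fun s _ => ?_
  rw [variance_eq_sub (hX.memLp_score_sq hc s), hX.integral_score_sq hc]
  have e4 : ∫ ω, ((fun ω => D.score c (fun i j => X i j ω) s ^ 2) ^ 2) ω ∂P = 3 * D.lam s ^ 2 := by
    rw [← hX.integral_score_pow_four hc]
    refine integral_congr_ae (ae_of_all _ fun ω => ?_)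
    simp only [Pi.pow_apply]; ring
  rw [e4]; ring

/-- A standardized quadratic form has the law of a linear combination of independent standardized
chi-squared variables with the standardized eigenvalues as coefficients. -/
theorem IsSample.charFun_quadratic (hX : D.IsSample P X) (hc : IsUnitWeights c) (t : ℝ) :
    charFun (P.map fun ω => (∑ s, D.score c (fun i j => X i j ω) s ^ 2 - ∑ s, D.lam s) /
      √(2 * ∑ s, D.lam s ^ 2)) t =
      ∏ s, stdChiSqCharFun (D.lam s / √(∑ s, D.lam s ^ 2) * t) := by
  set σ := √(∑ s, D.lam s ^ 2)
  have hσ : √(2 * ∑ s, D.lam s ^ 2) = √2 * σ := Real.sqrt_mul (by norm_num) _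
  have e : (fun ω => (∑ s, D.score c (fun i j => X i j ω) s ^ 2 - ∑ s, D.lam s) /
      √(2 * ∑ s, D.lam s ^ 2)) =
      fun ω => ∑ s, (D.score c (fun i j => X i j ω) s ^ 2 - D.lam s) / (√2 * σ) := by
    ext ω; rw [hσ, ← Finset.sum_sub_distrib, Finset.sum_div]
  have hind : iIndepFun (fun s ω => (D.score c (fun i j => X i j ω) s ^ 2 - D.lam s) / (√2 * σ))
      P := (hX.iIndepFun_score_single hc).comp (fun s x => (x ^ 2 - D.lam s) / (√2 * σ))
        fun s => by fun_prop
  rw [e, hind.charFun_map_fun_sum_eq_prod fun s =>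
    (((hX.aemeasurable_score c s).pow_const 2).sub_const _).div_const _, Finset.prod_apply]
  refine Finset.prod_congr rfl fun s _ => ?_
  -- a centred normal variable of variance `lam s` is `√(lam s)` times a standard normal one
  have h1 : P.map (fun ω => (D.score c (fun i j => X i j ω) s ^ 2 - D.lam s) / (√2 * σ)) =
      (gaussianReal 0 1).map fun x => (D.lam s / σ) * ((x ^ 2 - 1) / √2) := by
    have a := AEMeasurable.map_map_of_aemeasurable (μ := P)
      (f := fun ω => D.score c (fun i j => X i j ω) s)
      (g := fun x : ℝ => (x ^ 2 - D.lam s) / (√2 * σ)) (by fun_prop) (hX.aemeasurable_score c s)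
    have hg : gaussianReal 0 (D.lam s).toNNReal =
        (gaussianReal 0 1).map fun x => √(D.lam s) * x := by
      rw [gaussianReal_map_const_mul]
      congr 1
      · simp
      · ext; simp [Real.sq_sqrt (D.lam_nonneg s), D.lam_nonneg s]
    rw [(hX.hasLaw_score hc s).map_eq, hg, Measure.map_map (by fun_prop) (by fun_prop)] at a
    rw [Function.comp_def, Function.comp_def] at a
    rw [← a]
    congr 1
    ext x
    rw [mul_pow, Real.sq_sqrt (D.lam_nonneg s), div_mul_div_comm, mul_comm √2 σ]
    congr 1; ring
  have h2 := charFun_map_mul_comp (μ := gaussianReal 0 1) (f := fun x : ℝ => (x ^ 2 - 1) / √2)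
    (by fun_prop) (D.lam s / σ) t
  rw [h1, h2]
  rfl

end Moments

section Bilinear

variable {c c' : D.Weights}

/-- The coefficients `c` and `c'` are orthogonal within every group. -/
def IsOrthogonalWeights (c c' : D.Weights) : Prop := ∀ i, ∑ j, c i j * c' i j = 0

/-- The bilinear form in two independent scores: its square is unbiased for the sum of the squared
eigenvalues, and the second moment of this square is bounded by a multiple of the squared mean. -/
theorem IsSample.moments_bilinear (hX : D.IsSample P X) (hc : IsUnitWeights c)
    (hc' : IsUnitWeights c') (hcc' : IsOrthogonalWeights c c') :
    Integrable (fun ω => (∑ s, D.score c (fun i j => X i j ω) s *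
        D.score c' (fun i j => X i j ω) s) ^ 4) P ∧
      ∫ ω, (∑ s, D.score c (fun i j => X i j ω) s * D.score c' (fun i j => X i j ω) s) ^ 2 ∂P =
        ∑ s, D.lam s ^ 2 ∧
      ∫ ω, (∑ s, D.score c (fun i j => X i j ω) s * D.score c' (fun i j => X i j ω) s) ^ 4 ∂P ≤
        9 * (∑ s, D.lam s ^ 2) ^ 2 := by
  have := hX.isProbabilityMeasure
  have hind : ∀ s, IndepFun (fun ω => D.score c (fun i j => X i j ω) s)
      (fun ω => D.score c' (fun i j => X i j ω) s) P := fun s => by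
    have h := hX.indepFun_score (κ := Unit) (κ' := Unit) (c := fun _ => c) (c' := fun _ => c')
      fun _ _ => hcc'
    exact h.comp (measurable_pi_apply ((), s)) (measurable_pi_apply ((), s))
  have hpow : ∀ s (k : ℕ), IndepFun (fun ω => D.score c (fun i j => X i j ω) s ^ k)
      (fun ω => D.score c' (fun i j => X i j ω) s ^ k) P := fun s k =>
    (hind s).comp (measurable_id.pow_const k) (measurable_id.pow_const k)
  have hint : ∀ s (k : ℕ), Integrable (fun ω => (D.score c (fun i j => X i j ω) s *
      D.score c' (fun i j => X i j ω) s) ^ k) P := fun s k => by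
    simp_rw [mul_pow]
    exact (hpow s k).integrable_mul (hX.integrable_score_pow hc s k)
      (hX.integrable_score_pow hc' s k)
  have hmom : ∀ s (k : ℕ), ∫ ω, (D.score c (fun i j => X i j ω) s *
      D.score c' (fun i j => X i j ω) s) ^ k ∂P = (∫ ω, D.score c (fun i j => X i j ω) s ^ k ∂P) *
        ∫ ω, D.score c' (fun i j => X i j ω) s ^ k ∂P := fun s k => by
    simp_rw [mul_pow]
    exact (hpow s k).integral_fun_mul_eq_mul_integral (hX.integrable_score_pow hc s k).1
      (hX.integrable_score_pow hc' s k).1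
  have hblock : iIndepFun (fun s ω => D.score c (fun i j => X i j ω) s *
      D.score c' (fun i j => X i j ω) s) P := by
    have h := hX.iIndepFun_score (κ := Bool) (c := fun k => bif k then c else c')
      (r := fun k k' => if k = k' then 1 else 0) (by
        intro k k' i
        have h2 : ∑ j, c' i j * c i j = 0 := by simpa only [mul_comm] using hcc' i
        cases k <;> cases k' <;> simp [hc i, hc' i, hcc' i, h2])
    exact h.comp (fun s x => x true * x false)
      fun s => (measurable_pi_apply _).mul (measurable_pi_apply _)
  have h := moments_sum_of_iIndepFun (v := fun s => D.lam s ^ 2)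
    (η := fun s ω => D.score c (fun i j => X i j ω) s * D.score c' (fun i j => X i j ω) s)
    (fun s => (hX.aemeasurable_score c s).mul (hX.aemeasurable_score c' s)) hblock
    (fun s => hint s 4) (fun s => ?_) (fun s => ?_) (fun s => ?_) Finset.univ
  · exact ⟨h.1, h.2.2⟩
  · have := hmom s 1
    simpa [hX.integral_score] using this
  · rw [hmom, hX.integral_score_sq hc, hX.integral_score_sq hc', sq]
  · rw [hmom, hX.integral_score_pow_four hc, hX.integral_score_pow_four hc']
    exact le_of_eq (by ring)

end Bilinear

end SplitPlotDesign

/-! ### The quadratic form and the kernels of the estimators in terms of scores -/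

namespace SplitPlotDesign

variable {D : SplitPlotDesign}

/-- The coefficients of the centred and scaled group means. -/
noncomputable def meanWeights (D : SplitPlotDesign) : D.Weights :=
  fun i _ => √(D.N : ℝ) / (D.n i : ℝ)

theorem isUnitWeights_meanWeights : IsUnitWeights D.meanWeights := fun i => by
  have h : (D.n i : ℝ) ≠ 0 := Nat.cast_ne_zero.2 (D.n_pos i).ne'
  simp only [meanWeights, Finset.sum_const, Finset.card_univ, Fintype.card_fin, nsmul_eq_mul]
  rw [div_mul_div_comm, Real.mul_self_sqrt (Nat.cast_nonneg _)]
  field_simp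

/-- Under the null hypothesis the quadratic form does not depend on the mean vector. -/
theorem Q_eq_sum_score (h0 : D.NullHypothesis) (x : D.Data) :
    D.Q x = ∑ s, D.score D.meanWeights x s ^ 2 := by
  have e : D.combo D.meanWeights x = √(D.N : ℝ) • (D.pooledSampleMean x - D.pooledMean) := by
    ext p
    have h : (D.n p.1 : ℝ) ≠ 0 := Nat.cast_ne_zero.2 (D.n_pos p.1).ne'
    simp only [combo, meanWeights, pooledSampleMean, pooledMean, Pi.smul_apply, Pi.sub_apply,
      smul_eq_mul]
    rw [← Finset.mul_sum, Finset.sum_sub_distrib, Finset.sum_const, Finset.card_univ,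
      Fintype.card_fin, nsmul_eq_mul]
    field_simp
  have hT : D.T *ᵥ (D.pooledSampleMean x - D.pooledMean) = D.T *ᵥ D.pooledSampleMean x := by
    rw [Matrix.mulVec_sub, show D.T *ᵥ D.pooledMean = 0 from h0, sub_zero]
  have h1 : D.pooledMean ⬝ᵥ D.T *ᵥ D.pooledSampleMean x = 0 := by
    rw [Matrix.dotProduct_mulVec, ← Matrix.mulVec_transpose, D.T_symm.eq,
      show D.T *ᵥ D.pooledMean = 0 from h0, zero_dotProduct]
  have := D.combo_dotProduct_combo D.meanWeights D.meanWeights x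
  simp_rw [sq]
  rw [← this, e, Matrix.mulVec_smul, hT, smul_dotProduct, dotProduct_smul, sub_dotProduct, h1,
    sub_zero, smul_eq_mul, smul_eq_mul, ← mul_assoc, Real.mul_self_sqrt (Nat.cast_nonneg _)]
  rfl

/-- An `m`-tuple of subjects for every group. -/
abbrev Tuples (D : SplitPlotDesign) (m : ℕ) : Type := (i : Fin D.a) → Fin m → Fin (D.n i)

/-- The coefficients of the scaled difference of two observations in every group. The factor
`1 / √2` makes the covariance matrix of the combination equal to `V_N`. -/
noncomputable def diffWeights {m : ℕ} (l : D.Tuples m) (r s : Fin m) : D.Weights := fun i j =>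
  √((D.N : ℝ) / (D.n i : ℝ)) / √2 * ((if j = l i r then 1 else 0) - if j = l i s then 1 else 0)

theorem Z_eq_combo {m : ℕ} (l : D.Tuples m) (r s : Fin m) (x : D.Data) :
    D.Z x (fun i => l i r) (fun i => l i s) = √2 • D.combo (diffWeights l r s) x := by
  ext p
  simp only [Z, combo, diffWeights, Pi.smul_apply, smul_eq_mul]
  have h2 : √(2 : ℝ) ≠ 0 := by positivity
  have e : ∀ j, √((D.N : ℝ) / (D.n p.1 : ℝ)) / √2 *
      ((if j = l p.1 r then 1 else 0) - if j = l p.1 s then 1 else 0) *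
        (x p.1 j p.2 - D.mean p.1 p.2) = √((D.N : ℝ) / (D.n p.1 : ℝ)) / √2 *
      ((if j = l p.1 r then x p.1 j p.2 - D.mean p.1 p.2 else 0) -
        if j = l p.1 s then x p.1 j p.2 - D.mean p.1 p.2 else 0) := fun j => by
    split_ifs <;> ring
  simp_rw [e, ← Finset.mul_sum, Finset.sum_sub_distrib, Finset.sum_ite_eq', Finset.mem_univ,
    if_true]
  field_simp
  ring

theorem sum_diffWeights_mul {m m' : ℕ} (l : D.Tuples m) (l' : D.Tuples m') (r s : Fin m)
    (r' s' : Fin m') (i : Fin D.a) :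
    ∑ j, diffWeights l r s i j * diffWeights l' r' s' i j =
      (D.N : ℝ) / (D.n i : ℝ) / 2 * ((if l i r = l' i r' then 1 else 0) -
        (if l i r = l' i s' then 1 else 0) - (if l i s = l' i r' then 1 else 0) +
          if l i s = l' i s' then 1 else 0) := by
  simp only [diffWeights]
  have e : ∀ j, √((D.N : ℝ) / (D.n i : ℝ)) / √2 *
      ((if j = l i r then 1 else 0) - if j = l i s then 1 else 0) *
      (√((D.N : ℝ) / (D.n i : ℝ)) / √2 *
      ((if j = l' i r' then 1 else 0) - if j = l' i s' then 1 else 0)) =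
      (D.N : ℝ) / (D.n i : ℝ) / 2 *
        ((if j = l i r then ((if j = l' i r' then 1 else 0) - if j = l' i s' then 1 else 0) else 0) -
        if j = l i s then ((if j = l' i r' then 1 else 0) - if j = l' i s' then 1 else 0) else 0) :=
      fun j => by
    rw [mul_mul_mul_comm, div_mul_div_comm, Real.mul_self_sqrt (D.weight_pos i).le,
      Real.mul_self_sqrt (by norm_num)]
    congr 1
    split_ifs <;> ring
  simp_rw [e, ← Finset.mul_sum, Finset.sum_sub_distrib, Finset.sum_ite_eq', Finset.mem_univ,
    if_true]
  ring

/-- In every group the subjects of the tuple are distinct. -/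
def IsDistinct {m : ℕ} (l : D.Tuples m) : Prop := ∀ i, Function.Injective (l i)

/-- In every group the two tuples have no subject in common. -/
def AreDisjoint {m : ℕ} (l l' : D.Tuples m) : Prop := ∀ i r r', l i r ≠ l' i r'

theorem isUnitWeights_diffWeights {m : ℕ} {l : D.Tuples m} (hl : IsDistinct l) {r s : Fin m}
    (hrs : r ≠ s) : IsUnitWeights (diffWeights l r s) := fun i => by
  have h1 : l i r ≠ l i s := fun e => hrs (hl i e)
  rw [sum_diffWeights_mul]
  simp only [h1, h1.symm, if_true, if_false]
  ring

theorem isOrthogonalWeights_diffWeights {m : ℕ} {l l' : D.Tuples m} {r s r' s' : Fin m}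
    (h : ∀ i, l i r ≠ l' i r' ∧ l i r ≠ l' i s' ∧ l i s ≠ l' i r' ∧ l i s ≠ l' i s') :
    IsOrthogonalWeights (diffWeights l r s) (diffWeights l' r' s') := fun i => by
  obtain ⟨h1, h2, h3, h4⟩ := h i
  rw [sum_diffWeights_mul]
  simp [h1, h2, h3, h4]

/-- The summand of the trace estimator `A₁`. -/
noncomputable def kernelOne (l : D.Tuples 2) (x : D.Data) : ℝ :=
  (D.Z x (fun i => l i 0) (fun i => l i 1) ⬝ᵥ D.T *ᵥ D.Z x (fun i => l i 0) (fun i => l i 1)) / 2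

/-- The summand of the trace estimator `A₂`. -/
noncomputable def kernelTwo (l : D.Tuples 4) (x : D.Data) : ℝ :=
  (D.Z x (fun i => l i 0) (fun i => l i 1) ⬝ᵥ
    D.T *ᵥ D.Z x (fun i => l i 2) (fun i => l i 3)) ^ 2 / 4

theorem Z_dotProduct_Z {m : ℕ} (l : D.Tuples m) (r s r' s' : Fin m) (x : D.Data) :
    D.Z x (fun i => l i r) (fun i => l i s) ⬝ᵥ D.T *ᵥ D.Z x (fun i => l i r') (fun i => l i s') =
      2 * ∑ p, D.score (diffWeights l r s) x p * D.score (diffWeights l r' s') x p := by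
  rw [Z_eq_combo, Z_eq_combo, Matrix.mulVec_smul, smul_dotProduct, dotProduct_smul,
    combo_dotProduct_combo, smul_eq_mul, smul_eq_mul, ← mul_assoc,
    Real.mul_self_sqrt (by norm_num)]

theorem kernelOne_eq (l : D.Tuples 2) (x : D.Data) :
    kernelOne l x = ∑ p, D.score (diffWeights l 0 1) x p ^ 2 := by
  rw [kernelOne, Z_dotProduct_Z, mul_div_cancel_left₀ _ (by norm_num)]
  simp_rw [sq]

theorem kernelTwo_eq (l : D.Tuples 4) (x : D.Data) :
    kernelTwo l x = (∑ p, D.score (diffWeights l 0 1) x p * D.score (diffWeights l 2 3) x p) ^ 2 := by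
  rw [kernelTwo, Z_dotProduct_Z]; ring

section Random

variable {Ω : Type*} [MeasurableSpace Ω] {P : Measure Ω}
  {X : (i : Fin D.a) → Fin (D.n i) → Ω → EuclideanSpace ℝ (Fin (D.d i))}

variable (P X) in
/-- The statistics `Y l`, indexed by tuples of distinct subjects, are unbiased for `θ`, have
variance at most `v`, and are uncorrelated for tuples without common subjects. -/
structure IsUnbiasedKernel {m : ℕ} (Y : D.Tuples m → D.Data → ℝ) (θ v : ℝ) : Prop where
  measurable : ∀ l, Measurable (Y l)
  memLp : ∀ l, IsDistinct l → MemLp (fun ω => Y l (fun i j => X i j ω)) 2 P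
  integral : ∀ l, IsDistinct l → ∫ ω, Y l (fun i j => X i j ω) ∂P = θ
  variance_le : ∀ l, IsDistinct l → variance (fun ω => Y l (fun i j => X i j ω)) P ≤ v
  covariance : ∀ l l', IsDistinct l → IsDistinct l' → AreDisjoint l l' →
    cov[fun ω => Y l (fun i j => X i j ω), fun ω => Y l' (fun i j => X i j ω); P] = 0

theorem measurable_score (c : D.Weights) (s : D.Idx) : Measurable fun x : D.Data => D.score c x s := by
  simp only [score, combo, Matrix.mulVec, dotProduct]
  fun_prop

theorem measurable_kernelOne (l : D.Tuples 2) : Measurable (kernelOne l) := by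
  rw [funext (kernelOne_eq l)]
  exact Finset.measurable_sum _ fun p _ => (measurable_score _ p).pow_const 2

theorem measurable_kernelTwo (l : D.Tuples 4) : Measurable (kernelTwo l) := by
  rw [funext (kernelTwo_eq l)]
  exact (Finset.measurable_sum _ fun p _ =>
    (measurable_score _ p).mul (measurable_score _ p)).pow_const 2

theorem IsSample.isUnbiasedKernel_kernelOne (hX : D.IsSample P X) :
    IsUnbiasedKernel P X (kernelOne (D := D)) (∑ s, D.lam s) (2 * ∑ s, D.lam s ^ 2) where
  measurable := measurable_kernelOne
  memLp l hl := by
    simp_rw [kernelOne_eq]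
    exact hX.memLp_quadratic (isUnitWeights_diffWeights hl (by decide))
  integral l hl := by
    simp_rw [kernelOne_eq]
    exact hX.integral_quadratic (isUnitWeights_diffWeights hl (by decide))
  variance_le l hl := by
    simp_rw [kernelOne_eq]
    exact (hX.variance_quadratic (isUnitWeights_diffWeights hl (by decide))).le
  covariance l l' hl hl' h := by
    have := hX.isProbabilityMeasure
    simp_rw [kernelOne_eq]
    refine IndepFun.covariance_eq_zero ?_
      (hX.memLp_quadratic (isUnitWeights_diffWeights hl (by decide)))
      (hX.memLp_quadratic (isUnitWeights_diffWeights hl' (by decide)))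
    have hi := hX.indepFun_score (κ := Unit) (κ' := Unit) (c := fun _ => diffWeights l 0 1)
      (c' := fun _ => diffWeights l' 0 1) fun _ _ =>
        isOrthogonalWeights_diffWeights fun i => ⟨h i _ _, h i _ _, h i _ _, h i _ _⟩
    have hm : Measurable fun y : Unit × D.Idx → ℝ => ∑ p, y ((), p) ^ 2 := by fun_prop
    exact hi.comp hm hm

theorem IsSample.isUnbiasedKernel_kernelTwo (hX : D.IsSample P X) :
    IsUnbiasedKernel P X (kernelTwo (D := D)) (∑ s, D.lam s ^ 2)
      (9 * (∑ s, D.lam s ^ 2) ^ 2) := by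
  have := hX.isProbabilityMeasure
  have mom : ∀ l : D.Tuples 4, IsDistinct l → _ := fun l hl =>
    hX.moments_bilinear (isUnitWeights_diffWeights hl (r := 0) (s := 1) (by decide))
      (isUnitWeights_diffWeights hl (r := 2) (s := 3) (by decide))
      (isOrthogonalWeights_diffWeights fun i => ⟨fun e => absurd (hl i e) (by decide),
        fun e => absurd (hl i e) (by decide), fun e => absurd (hl i e) (by decide),
        fun e => absurd (hl i e) (by decide)⟩)
  have haem : ∀ l : D.Tuples 4, AEMeasurable (fun ω => ∑ p,
      D.score (diffWeights l 0 1) (fun i j => X i j ω) p *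
        D.score (diffWeights l 2 3) (fun i j => X i j ω) p) P := fun l =>
    Finset.aemeasurable_fun_sum _ fun p _ =>
      (hX.aemeasurable_score _ p).mul (hX.aemeasurable_score _ p)
  have hmem : ∀ l : D.Tuples 4, IsDistinct l → MemLp (fun ω => (∑ p,
      D.score (diffWeights l 0 1) (fun i j => X i j ω) p *
        D.score (diffWeights l 2 3) (fun i j => X i j ω) p) ^ 2) 2 P := fun l hl => by
    rw [memLp_two_iff_integrable_sq ((haem l).pow_const 2).aestronglyMeasurable]
    simp_rw [← pow_mul]
    exact (mom l hl).1
  refine ⟨measurable_kernelTwo, fun l hl => ?_, fun l hl => ?_, fun l hl => ?_,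
    fun l l' hl hl' h => ?_⟩
  · simp_rw [kernelTwo_eq]
    exact hmem l hl
  · simp_rw [kernelTwo_eq]
    exact (mom l hl).2.1
  · simp_rw [kernelTwo_eq]
    refine (variance_le_expectation_sq ((haem l).pow_const 2).aestronglyMeasurable).trans
      (le_trans (le_of_eq ?_) (mom l hl).2.2)
    refine integral_congr_ae (ae_of_all _ fun ω => ?_)
    simp only [Pi.pow_apply]
    ring
  · simp_rw [kernelTwo_eq]
    refine IndepFun.covariance_eq_zero ?_ (hmem l hl) (hmem l' hl')
    have hi := hX.indepFun_score (κ := Bool) (κ' := Bool)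
      (c := fun k => bif k then diffWeights l 0 1 else diffWeights l 2 3)
      (c' := fun k => bif k then diffWeights l' 0 1 else diffWeights l' 2 3) fun k k' => by
        cases k <;> cases k' <;>
        exact isOrthogonalWeights_diffWeights fun i => ⟨h i _ _, h i _ _, h i _ _, h i _ _⟩
    have hm : Measurable fun y : Bool × D.Idx → ℝ => (∑ p, y (true, p) * y (false, p)) ^ 2 := by
      fun_prop
    exact hi.comp hm hm

end Random

end SplitPlotDesign

/-! ### Weighted averages and counting of subsamples -/

section Averages

variable {Ω : Type*} [MeasurableSpace Ω] {P : Measure Ω} [IsProbabilityMeasure P]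

theorem covariance_le_of_variance_le {Y Y' : Ω → ℝ} {v : ℝ} (hY : MemLp Y 2 P)
    (hY' : MemLp Y' 2 P) (h : variance Y P ≤ v) (h' : variance Y' P ≤ v) : cov[Y, Y'; P] ≤ v := by
  have h1 := variance_sub hY hY'
  have h2 := variance_nonneg (Y - Y') P
  linarith

/-- Chebyshev's inequality for a weighted average of random variables that are uncorrelated unless
their indices are related by `R`. -/
theorem measureReal_weighted_average_sub_le {κ : Type*} [Fintype κ] {w : κ → ℝ}
    (hw0 : ∀ k, 0 ≤ w k) (hw1 : ∑ k, w k = 1) {Y : κ → Ω → ℝ} {θ v : ℝ}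
    (hmem : ∀ k, w k ≠ 0 → MemLp (Y k) 2 P) (hmean : ∀ k, w k ≠ 0 → ∫ ω, Y k ω ∂P = θ)
    (hvar : ∀ k, w k ≠ 0 → variance (Y k) P ≤ v) (R : κ → κ → Prop) [DecidableRel R]
    (hcov : ∀ k k', w k ≠ 0 → w k' ≠ 0 → ¬ R k k' → cov[Y k, Y k'; P] = 0) {ε : ℝ} (hε : 0 < ε) :
    P.real {ω | ε < |∑ k, w k * Y k ω - θ|} ≤
      v / ε ^ 2 * ∑ k, ∑ k', if R k k' then w k * w k' else 0 := by
  have hmem' : ∀ k, MemLp (fun ω => w k * Y k ω) 2 P := fun k => by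
    by_cases h : w k = 0
    · simp [h]
    · exact (hmem k h).const_mul _
  have hS := memLp_finsetSum Finset.univ fun k _ => hmem' k
  have hE : ∫ ω, ∑ k, w k * Y k ω ∂P = θ := by
    rw [integral_finsetSum _ fun k _ => (hmem' k).integrable (by norm_num)]
    have : ∀ k, ∫ ω, w k * Y k ω ∂P = w k * θ := fun k => by
      rw [integral_const_mul]
      by_cases h : w k = 0
      · simp [h]
      · rw [hmean k h]
    simp_rw [this, ← Finset.sum_mul, hw1, one_mul]
  have hV : variance (fun ω => ∑ k, w k * Y k ω) P ≤
      v * ∑ k, ∑ k', if R k k' then w k * w k' else 0 := by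
    rw [variance_fun_sum hmem', Finset.mul_sum]
    refine Finset.sum_le_sum fun k _ => ?_
    rw [Finset.mul_sum]
    refine Finset.sum_le_sum fun k' _ => ?_
    rw [covariance_const_mul_left, covariance_const_mul_right]
    by_cases h : w k = 0
    · simp [h]
    by_cases h' : w k' = 0
    · simp [h']
    split_ifs with hR
    · have := covariance_le_of_variance_le (hmem k h) (hmem k' h') (hvar k h) (hvar k' h')
      rw [← mul_assoc, mul_comm v]
      exact mul_le_mul_of_nonneg_left this (mul_nonneg (hw0 k) (hw0 k'))
    · rw [hcov k k' h h' hR]; simp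
  have hC := meas_ge_le_variance_div_sq hS hε
  rw [hE] at hC
  calc P.real {ω | ε < |∑ k, w k * Y k ω - θ|}
      ≤ P.real {ω | ε ≤ |∑ k, w k * Y k ω - θ|} :=
        measureReal_mono (by intro ω h; simp only [Set.mem_ofPred_eq] at h ⊢; exact h.le)
    _ ≤ variance (fun ω => ∑ k, w k * Y k ω) P / ε ^ 2 := by
        refine ENNReal.toReal_le_of_le_ofReal ?_ hC
        exact div_nonneg (variance_nonneg _ _) (sq_nonneg _)
    _ ≤ _ := by
        rw [div_mul_eq_mul_div]
        gcongr

end Averages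

section Counting

/-- Two independent random `m`-tuples, with point probabilities `w` and `w'`, whose underlying sets
are uniformly distributed `m`-subsets of `Fin n` are disjoint with probability at least
`(n - m).choose m / n.choose m`. -/
theorem choose_div_choose_le_sum_disjoint {m n : ℕ} {w w' : (Fin m → Fin n) → ℝ}
    (hw0 : ∀ f, 0 ≤ w f) (hw0' : ∀ f, 0 ≤ w' f)
    (hw : ∀ S : Finset (Fin n), S.card = m →
      ∑ f with Finset.univ.image f = S, w f = ((n.choose m : ℝ))⁻¹)
    (hw' : ∀ S : Finset (Fin n), S.card = m →
      ∑ f with Finset.univ.image f = S, w' f = ((n.choose m : ℝ))⁻¹) (hmn : m ≤ n) :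
    ((n - m).choose m : ℝ) / (n.choose m : ℝ) ≤
      ∑ f, ∑ f', if ∀ r r', f r ≠ f' r' then w f * w' f' else 0 := by
  have hC : (n.choose m : ℝ) ≠ 0 := Nat.cast_ne_zero.2 (Nat.choose_pos hmn).ne'
  have h1 : ∀ f : Fin m → Fin n, (Finset.univ.image f).card = m →
      w f * (((n - m).choose m : ℝ) * ((n.choose m : ℝ))⁻¹) ≤
      ∑ f', if ∀ r r', f r ≠ f' r' then w f * w' f' else 0 := fun f hf => by
    set S := Finset.univ.image f
    have hc : ((Sᶜ).powersetCard m).card = (n - m).choose m := by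
      rw [Finset.card_powersetCard, Finset.card_compl, hf, Fintype.card_fin]
    calc w f * (((n - m).choose m : ℝ) * ((n.choose m : ℝ))⁻¹)
        = w f * ∑ S' ∈ (Sᶜ).powersetCard m, ∑ f' with Finset.univ.image f' = S', w' f' := by
          rw [Finset.sum_congr rfl fun S' hS' => hw' S' (Finset.mem_powersetCard.1 hS').2,
            Finset.sum_const, hc, nsmul_eq_mul]
      _ = w f * ∑ f' with Finset.univ.image f' ∈ (Sᶜ).powersetCard m, w' f' := by
          rw [← Finset.sum_fiberwise_of_maps_to (s := Finset.univ.filter fun f' : Fin m → Fin n =>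
            Finset.univ.image f' ∈ (Sᶜ).powersetCard m) (t := (Sᶜ).powersetCard m)
            (g := fun f' => Finset.univ.image f') (by simp)]
          congr 1
          refine Finset.sum_congr rfl fun S' hS' => ?_
          rw [Finset.filter_filter]
          refine Finset.sum_congr (Finset.filter_congr fun f' _ => ?_) fun _ _ => rfl
          constructor
          · rintro rfl; exact ⟨hS', rfl⟩
          · exact fun h => h.2
      _ ≤ w f * ∑ f' with ∀ r r', f r ≠ f' r', w' f' := by
          refine mul_le_mul_of_nonneg_left ?_ (hw0 f)
          refine Finset.sum_le_sum_of_subset_of_nonneg (fun f' hf' => ?_) fun f' _ _ => hw0' f'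
          simp only [Finset.mem_filter, Finset.mem_univ, true_and, Finset.mem_powersetCard] at hf' ⊢
          intro r r' e
          have h2 := hf'.1 (Finset.mem_image_of_mem f' (Finset.mem_univ r'))
          rw [Finset.mem_compl] at h2
          exact h2 (e ▸ Finset.mem_image_of_mem f (Finset.mem_univ r))
      _ = _ := by rw [Finset.mul_sum, Finset.sum_filter]
  calc ((n - m).choose m : ℝ) / (n.choose m : ℝ)
      = ∑ S ∈ (Finset.univ : Finset (Fin n)).powersetCard m,
          (∑ f with Finset.univ.image f = S, w f) *
            (((n - m).choose m : ℝ) * ((n.choose m : ℝ))⁻¹) := by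
        rw [Finset.sum_congr rfl fun S hS => by rw [hw S (Finset.mem_powersetCard.1 hS).2],
          Finset.sum_const, Finset.card_powersetCard, Finset.card_univ, Fintype.card_fin,
          nsmul_eq_mul]
        field_simp
    _ ≤ ∑ S ∈ (Finset.univ : Finset (Fin n)).powersetCard m, ∑ f with Finset.univ.image f = S,
          ∑ f', if ∀ r r', f r ≠ f' r' then w f * w' f' else 0 := by
        refine Finset.sum_le_sum fun S hS => ?_
        rw [Finset.sum_mul]
        refine Finset.sum_le_sum fun f hf => h1 f ?_
        rw [(Finset.mem_filter.1 hf).2, (Finset.mem_powersetCard.1 hS).2]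
    _ ≤ ∑ S : Finset (Fin n), ∑ f with Finset.univ.image f = S,
          ∑ f', if ∀ r r', f r ≠ f' r' then w f * w' f' else 0 := by
        refine Finset.sum_le_sum_of_subset_of_nonneg (Finset.subset_univ _) fun S _ _ => ?_
        refine Finset.sum_nonneg fun f _ => Finset.sum_nonneg fun f' _ => ?_
        split_ifs
        · exact mul_nonneg (hw0 f) (hw0' f')
        · exact le_rfl
    _ = _ := Finset.sum_fiberwise _ _ _

/-- The number of listings of an `m`-set that satisfy a condition depending only on the relative
order of the entries. -/
theorem card_filter_image_eq {m n : ℕ} (p : (k : ℕ) → (Fin m → Fin k) → Prop)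
    [∀ k, DecidablePred (p k)] (hinj : ∀ k f, p k f → Function.Injective f)
    (hp : ∀ (e : Fin m ↪o Fin n) (g : Fin m → Fin m), p n (e ∘ g) ↔ p m g) {S : Finset (Fin n)}
    (hS : S.card = m) :
    (Finset.univ.filter fun f => p n f ∧ Finset.univ.image f = S).card =
      (Finset.univ.filter (p m)).card := by
  symm
  set e := S.orderEmbOfFin hS
  refine Finset.card_bij (fun g _ => e ∘ g) (fun g hg => ?_) (fun g _ g' _ h => ?_)
    fun f hf => ?_
  · simp only [Finset.mem_filter, Finset.mem_univ, true_and] at hg ⊢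
    refine ⟨(hp e g).2 hg, ?_⟩
    have hs : Function.Surjective g := Finite.surjective_of_injective (hinj _ _ hg)
    rw [← Finset.image_image, Finset.image_univ_of_surjective hs]
    exact Finset.image_orderEmbOfFin_univ S hS
  · exact funext fun r => e.injective (congrFun h r)
  · simp only [Finset.mem_filter, Finset.mem_univ, true_and] at hf
    have h1 : ∀ r, ∃ q, e q = f r := fun r => by
      have : f r ∈ S := hf.2 ▸ Finset.mem_image_of_mem f (Finset.mem_univ r)
      rw [← Finset.mem_coe, ← Finset.range_orderEmbOfFin S hS] at this
      exact this
    choose g hg using h1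
    have he : e ∘ g = f := funext hg
    exact ⟨g, by simpa using (hp e g).1 (he ▸ hf.1), he⟩

theorem card_filter_eq_mul_choose {m n : ℕ} (p : (k : ℕ) → (Fin m → Fin k) → Prop)
    [∀ k, DecidablePred (p k)] (hinj : ∀ k f, p k f → Function.Injective f)
    (hp : ∀ (e : Fin m ↪o Fin n) (g : Fin m → Fin m), p n (e ∘ g) ↔ p m g) :
    (Finset.univ.filter (p n)).card = n.choose m * (Finset.univ.filter (p m)).card := by
  rw [Finset.card_eq_sum_card_fiberwise (f := fun f : Fin m → Fin n => Finset.univ.image f)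
    (t := (Finset.univ : Finset (Fin n)).powersetCard m) fun f hf => by
      have hf' := hinj _ _ (Finset.mem_filter.1 hf).2
      simp [Finset.card_image_of_injective _ hf']]
  rw [Finset.sum_congr rfl fun S hS => by
    rw [Finset.filter_filter, card_filter_image_eq p hinj hp (Finset.mem_powersetCard.1 hS).2]]
  simp

theorem sum_prod_mul_prod_ite {a m : ℕ} {n : Fin a → ℕ}
    (w w' : (i : Fin a) → (Fin m → Fin (n i)) → ℝ)
    (p : (i : Fin a) → (Fin m → Fin (n i)) → (Fin m → Fin (n i)) → Prop)
    [∀ i f f', Decidable (p i f f')] :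
    (∑ l : (i : Fin a) → Fin m → Fin (n i), ∑ l' : (i : Fin a) → Fin m → Fin (n i),
      if ∀ i, p i (l i) (l' i) then (∏ i, w i (l i)) * ∏ i, w' i (l' i) else 0) =
      ∏ i, ∑ f, ∑ f', if p i f f' then w i f * w' i f' else 0 := by
  rw [Fintype.prod_sum]
  refine Finset.sum_congr rfl fun l _ => ?_
  rw [Fintype.prod_sum]
  refine Finset.sum_congr rfl fun l' _ => ?_
  split_ifs with h
  · rw [← Finset.prod_mul_distrib]
    exact Finset.prod_congr rfl fun i _ => (if_pos (h i)).symm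
  · push Not at h
    obtain ⟨i, hi⟩ := h
    exact (Finset.prod_eq_zero (Finset.mem_univ i) (if_neg hi)).symm

theorem choose_div_choose_eq {m n : ℕ} (h : 2 * m ≤ n) :
    ((n - m).choose m : ℝ) / (n.choose m : ℝ) =
      (((n - m)! : ℝ) * ((n - m)! : ℝ)) / ((n ! : ℝ) * ((n - 2 * m)! : ℝ)) := by
  rw [Nat.cast_choose ℝ (by omega : m ≤ n - m), Nat.cast_choose ℝ (by omega : m ≤ n),
    show n - m - m = n - 2 * m by omega]
  have h1 : ((n - m)! : ℝ) ≠ 0 := Nat.cast_ne_zero.2 (Nat.factorial_ne_zero _)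
  have h2 : ((n - 2 * m)! : ℝ) ≠ 0 := Nat.cast_ne_zero.2 (Nat.factorial_ne_zero _)
  have h3 : (n ! : ℝ) ≠ 0 := Nat.cast_ne_zero.2 (Nat.factorial_ne_zero _)
  have h4 : (m ! : ℝ) ≠ 0 := Nat.cast_ne_zero.2 (Nat.factorial_ne_zero _)
  field_simp

end Counting

/-! ### Consistency of the estimators `A₁` and `A₂` -/

namespace SplitPlotDesign

variable {D : SplitPlotDesign}

/-- The probability that two independent uniform `m`-subsamples of every group have no common
subject. -/
noncomputable def disjointRatio (D : SplitPlotDesign) (m : ℕ) : ℝ :=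
  ∏ i, ((D.n i - m).choose m : ℝ) / ((D.n i).choose m : ℝ)

theorem disjointRatio_le_sum {m : ℕ} {w w' : (i : Fin D.a) → (Fin m → Fin (D.n i)) → ℝ}
    (hw0 : ∀ i f, 0 ≤ w i f) (hw0' : ∀ i f, 0 ≤ w' i f)
    (hw : ∀ i (S : Finset (Fin (D.n i))), S.card = m →
      ∑ f with Finset.univ.image f = S, w i f = (((D.n i).choose m : ℝ))⁻¹)
    (hw' : ∀ i (S : Finset (Fin (D.n i))), S.card = m →
      ∑ f with Finset.univ.image f = S, w' i f = (((D.n i).choose m : ℝ))⁻¹)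
    (hn : ∀ i, m ≤ D.n i) [DecidableRel (AreDisjoint (D := D) (m := m))] :
    D.disjointRatio m ≤ ∑ l : D.Tuples m, ∑ l' : D.Tuples m,
      if AreDisjoint l l' then (∏ i, w i (l i)) * ∏ i, w' i (l' i) else 0 := by
  have h := sum_prod_mul_prod_ite w w' (fun i f f' => ∀ r r', f r ≠ f' r')
  calc D.disjointRatio m ≤ ∏ i, ∑ f, ∑ f', if ∀ r r', f r ≠ f' r' then w i f * w' i f' else 0 := by
        refine Finset.prod_le_prod (fun i _ => by positivity) fun i _ => ?_
        exact choose_div_choose_le_sum_disjoint (hw0 i) (hw0' i) (hw i) (hw' i) (hn i)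
    _ = _ := by
        rw [← h]
        refine Finset.sum_congr rfl fun l _ => Finset.sum_congr rfl fun l' _ => ?_
        exact if_congr Iff.rfl rfl rfl

section Random

variable {Ω : Type*} [MeasurableSpace Ω] {P : Measure Ω} [IsProbabilityMeasure P]
  {X : (i : Fin D.a) → Fin (D.n i) → Ω → EuclideanSpace ℝ (Fin (D.d i))}

open Classical in
/-- The deviation of the average of a kernel over all tuples satisfying a condition `p` in every
group. As `p` depends only on the relative order of the entries, every `m`-subset has the same
number `c` of admissible listings, so that the average runs over uniform subsamples. -/
theorem IsUnbiasedKernel.measureReal_average_le {m : ℕ} {Y : D.Tuples m → D.Data → ℝ} {θ v : ℝ}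
    (hY : IsUnbiasedKernel P X Y θ v) (p : (k : ℕ) → (Fin m → Fin k) → Prop)
    (hinj : ∀ k f, p k f → Function.Injective f)
    (hp : ∀ k (e : Fin m ↪o Fin k) (g : Fin m → Fin m), p k (e ∘ g) ↔ p m g)
    {c : ℕ} (hc : (Finset.univ.filter (p m)).card = c) (hc0 : c ≠ 0) (hn : ∀ i, m ≤ D.n i)
    {ε : ℝ} (hε : 0 < ε) :
    P.real {ω | ε < |(∑ l : D.Tuples m with ∀ i, p (D.n i) (l i), Y l (fun i j => X i j ω) /
      ∏ i, ((c : ℝ) * ((D.n i).choose m : ℝ))) - θ|} ≤ v / ε ^ 2 * (1 - D.disjointRatio m) := by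
  set w : (i : Fin D.a) → (Fin m → Fin (D.n i)) → ℝ := fun i f =>
    if p (D.n i) f then ((c : ℝ) * ((D.n i).choose m : ℝ))⁻¹ else 0 with hw
  have hC : ∀ i, ((D.n i).choose m : ℝ) ≠ 0 := fun i =>
    Nat.cast_ne_zero.2 (Nat.choose_pos (hn i)).ne'
  have hc0' : (c : ℝ) ≠ 0 := Nat.cast_ne_zero.2 hc0
  have hw0 : ∀ i f, 0 ≤ w i f := fun i f => by
    simp only [hw]; split_ifs <;> positivity
  have hw1 : ∀ i, ∑ f, w i f = 1 := fun i => by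
    simp only [hw]
    rw [← Finset.sum_filter, Finset.sum_const, card_filter_eq_mul_choose p hinj (hp _), hc,
      nsmul_eq_mul]
    push_cast
    rw [mul_comm, inv_mul_eq_div, mul_comm]
    exact div_self (mul_ne_zero hc0' (hC i))
  have hwS : ∀ i (S : Finset (Fin (D.n i))), S.card = m →
      ∑ f with Finset.univ.image f = S, w i f = (((D.n i).choose m : ℝ))⁻¹ := fun i S hS => by
    simp only [hw]
    rw [← Finset.sum_filter, Finset.sum_const, Finset.filter_filter,
      Finset.filter_congr fun f _ => And.comm, card_filter_image_eq p hinj (hp _) hS, hc,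
      nsmul_eq_mul, mul_inv, mul_inv_cancel_left₀ hc0']
  set W : D.Tuples m → ℝ := fun l => ∏ i, w i (l i) with hWdef
  have hW0 : ∀ l, 0 ≤ W l := fun l => Finset.prod_nonneg fun i _ => hw0 i _
  have hW1 : ∑ l, W l = 1 := by
    have := Fintype.prod_sum (f := fun i f => w i f)
    rw [← this]
    exact Finset.prod_eq_one fun i _ => hw1 i
  have hWp : ∀ l, W l ≠ 0 → ∀ i, p (D.n i) (l i) := fun l hl i => by
    by_contra h
    exact hl (Finset.prod_eq_zero (Finset.mem_univ i) (if_neg h))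
  have hWd : ∀ l, W l ≠ 0 → IsDistinct l := fun l hl i => hinj _ _ (hWp l hl i)
  have hsum : ∀ ω, (∑ l : D.Tuples m with ∀ i, p (D.n i) (l i), Y l (fun i j => X i j ω) /
      ∏ i, ((c : ℝ) * ((D.n i).choose m : ℝ))) = ∑ l, W l * Y l (fun i j => X i j ω) := fun ω => by
    rw [Finset.sum_filter]
    refine Finset.sum_congr rfl fun l _ => ?_
    split_ifs with h
    · have : W l = (∏ i, ((c : ℝ) * ((D.n i).choose m : ℝ)))⁻¹ := by
        rw [← Finset.prod_inv_distrib]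
        exact Finset.prod_congr rfl fun i _ => if_pos (h i)
      rw [this, div_eq_inv_mul]
    · have : W l = 0 := by
        by_contra hl
        exact h (hWp l hl)
      rw [this, zero_mul]
  simp_rw [hsum]
  refine (measureReal_weighted_average_sub_le hW0 hW1 (fun l hl => hY.memLp l (hWd l hl))
    (fun l hl => hY.integral l (hWd l hl)) (fun l hl => hY.variance_le l (hWd l hl))
    (fun l l' => ¬ AreDisjoint l l') (fun l l' hl hl' h =>
      hY.covariance l l' (hWd l hl) (hWd l' hl') (not_not.1 h)) hε).trans ?_
  have hv : 0 ≤ v := by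
    obtain ⟨l, hl⟩ : ∃ l, W l ≠ 0 := by
      by_contra! h
      simp [h] at hW1
    exact (variance_nonneg _ _).trans (hY.variance_le l (hWd l hl))
  refine mul_le_mul_of_nonneg_left ?_ (by positivity)
  have h1 := disjointRatio_le_sum hw0 hw0 hwS hwS hn
  have h2 : ∑ l, ∑ l', W l * W l' = 1 := by
    simp_rw [← Finset.mul_sum, hW1, mul_one]
    exact hW1
  have h3 : (∑ l, ∑ l', if ¬ AreDisjoint l l' then W l * W l' else 0) =
      (∑ l, ∑ l', W l * W l') - ∑ l, ∑ l', if AreDisjoint l l' then W l * W l' else 0 := by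
    rw [← Finset.sum_sub_distrib]
    refine Finset.sum_congr rfl fun l _ => ?_
    rw [← Finset.sum_sub_distrib]
    refine Finset.sum_congr rfl fun l' _ => ?_
    by_cases h : AreDisjoint l l'
    · rw [if_neg (not_not.2 h), if_pos h, sub_self]
    · rw [if_pos h, if_neg h, sub_zero]
  rw [h3, h2]
  linarith

end Random

/-- The order condition on the pairs of the trace estimator `A₁`. -/
def PairCondition (k : ℕ) (f : Fin 2 → Fin k) : Prop := f 0 < f 1

/-- The order condition on the quadruples of the trace estimator `A₂`. -/
def QuadCondition (k : ℕ) (f : Fin 4 → Fin k) : Prop :=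
  Function.Injective f ∧ f 0 < f 1 ∧ f 2 < f 3

theorem PairCondition.injective (k : ℕ) (f : Fin 2 → Fin k) (h : PairCondition k f) :
    Function.Injective f := by
  have h' : f 0 < f 1 := h
  intro r s hrs
  fin_cases r <;> fin_cases s <;> simp_all

theorem pairCondition_comp (k : ℕ) (e : Fin 2 ↪o Fin k) (g : Fin 2 → Fin 2) :
    PairCondition k (e ∘ g) ↔ PairCondition 2 g := by
  simp [PairCondition]

theorem quadCondition_comp (k : ℕ) (e : Fin 4 ↪o Fin k) (g : Fin 4 → Fin 4) :
    QuadCondition k (e ∘ g) ↔ QuadCondition 4 g := by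
  simp [QuadCondition, e.injective.of_comp_iff]

open Classical in
theorem card_filter_pairCondition : (Finset.univ.filter (PairCondition 2)).card = 1 := by
  have : (Finset.univ.filter fun f : Fin 2 → Fin 2 => f 0 < f 1).card = 1 := by decide
  rw [← this]
  exact congrArg _ (Finset.filter_congr fun _ _ => Iff.rfl)

open Classical in
theorem card_filter_quadCondition : (Finset.univ.filter (QuadCondition 4)).card = 6 := by
  have : (Finset.univ.filter fun f : Fin 4 → Fin 4 =>
      (∀ r s, f r = f s → r = s) ∧ f 0 < f 1 ∧ f 2 < f 3).card = 6 := by decide +kernel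
  rw [← this]
  exact congrArg _ (Finset.filter_congr fun _ _ => Iff.rfl)

open Classical in
theorem A1_eq (x : D.Data) : D.A1 x = ∑ l : D.Tuples 2 with ∀ i, PairCondition (D.n i) (l i),
    kernelOne l x / ∏ i, (((1 : ℕ) : ℝ) * ((D.n i).choose 2 : ℝ)) := by
  unfold A1
  rw [Finset.sum_filter, Finset.sum_filter]
  refine Fintype.sum_equiv (Equiv.piComm _) _ _ fun l => ?_
  refine if_congr Iff.rfl ?_ rfl
  simp only [Nat.cast_one, one_mul, ← div_div]
  rfl

open Classical in
theorem A2_eq (x : D.Data) : D.A2 x = ∑ l : D.Tuples 4 with ∀ i, QuadCondition (D.n i) (l i),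
    kernelTwo l x / ∏ i, (((6 : ℕ) : ℝ) * ((D.n i).choose 4 : ℝ)) := by
  unfold A2
  rw [Finset.sum_filter, Finset.sum_filter]
  refine Fintype.sum_equiv (Equiv.piComm _) _ _ fun l => ?_
  refine if_congr Iff.rfl ?_ rfl
  simp only [Nat.cast_ofNat, ← div_div]
  rfl

section Random

variable {Ω : Type*} [MeasurableSpace Ω] {P : Measure Ω}
  {X : (i : Fin D.a) → Fin (D.n i) → Ω → EuclideanSpace ℝ (Fin (D.d i))}

theorem IsSample.measureReal_A1_sub_le (hX : D.IsSample P X) (hn : ∀ i, 2 ≤ D.n i) {ε : ℝ}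
    (hε : 0 < ε) : P.real {ω | ε < |D.A1 (fun i j => X i j ω) - ∑ s, D.lam s|} ≤
      (2 * ∑ s, D.lam s ^ 2) / ε ^ 2 * (1 - D.disjointRatio 2) := by
  have := hX.isProbabilityMeasure
  simp_rw [A1_eq]
  exact hX.isUnbiasedKernel_kernelOne.measureReal_average_le PairCondition PairCondition.injective
    pairCondition_comp card_filter_pairCondition one_ne_zero hn hε

theorem IsSample.measureReal_A2_sub_le (hX : D.IsSample P X) (hn : ∀ i, 4 ≤ D.n i) {ε : ℝ}
    (hε : 0 < ε) : P.real {ω | ε < |D.A2 (fun i j => X i j ω) - ∑ s, D.lam s ^ 2|} ≤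
      (9 * (∑ s, D.lam s ^ 2) ^ 2) / ε ^ 2 * (1 - D.disjointRatio 4) := by
  have := hX.isProbabilityMeasure
  simp_rw [A2_eq]
  exact hX.isUnbiasedKernel_kernelTwo.measureReal_average_le QuadCondition (fun k f h => h.1)
    quadCondition_comp card_filter_quadCondition (by norm_num) hn hε

end Random

end SplitPlotDesign

/-! ### Consistency of the subsampling estimators -/

section FiniteValued

variable {Ω : Type*} [MeasurableSpace Ω] {P : Measure Ω} [IsProbabilityMeasure P]

theorem measureReal_eq_sum_of_fintype {α : Type*} [Fintype α] [MeasurableSpace α]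
    [MeasurableSingletonClass α] {f : Ω → α} (hf : AEMeasurable f P) (p : α → Prop)
    [DecidablePred p] :
    P.real {ω | p (f ω)} = ∑ a, if p a then P.real {ω | f ω = a} else 0 := by
  have h : ∀ s : Set α, (P.map f).real s = P.real (f ⁻¹' s) := fun s =>
    map_measureReal_apply_of_aemeasurable hf (Set.toFinite s).measurableSet
  rw [← Finset.sum_filter]
  have h1 : P.real {ω | p (f ω)} = (P.map f).real (Finset.univ.filter p : Finset α) := by
    rw [h]
    congr 1
    ext ω
    simp
  rw [h1, ← sum_measureReal_singleton]
  refine Finset.sum_congr rfl fun a _ => ?_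
  rw [h]
  congr 1

end FiniteValued

namespace SplitPlotDesign

variable {D : SplitPlotDesign} {Ω : Type*} [MeasurableSpace Ω] {P : Measure Ω}
  {X : (i : Fin D.a) → Fin (D.n i) → Ω → EuclideanSpace ℝ (Fin (D.d i))} {m U : ℕ}
  {σ : Fin U → (i : Fin D.a) → Ω → Fin m → Fin (D.n i)}

namespace IsSubsampling

theorem sum_measureReal_image_eq [IsProbabilityMeasure P] (hσ : D.IsSubsampling P X m U σ)
    (u : Fin U) (i : Fin D.a) {S : Finset (Fin (D.n i))} (hS : S.card = m) :
    ∑ f with Finset.univ.image f = S, P.real {ω | σ u i ω = f} =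
      (((D.n i).choose m : ℝ))⁻¹ := by
  have h := measureReal_eq_sum_of_fintype (hσ.aemeasurable u i) fun f => Finset.univ.image f = S
  rw [Finset.sum_filter, ← h, measureReal_def, hσ.uniform u i S hS]
  simp

/-- Almost surely, a subsample consists of distinct subjects: the `m`-subsets already carry the
whole mass. -/
theorem measureReal_eq_zero_of_not_injective [IsProbabilityMeasure P]
    (hσ : D.IsSubsampling P X m U σ) (hn : ∀ i, m ≤ D.n i) (u : Fin U) (i : Fin D.a)
    {f : Fin m → Fin (D.n i)} (hf : ¬ Function.Injective f) :
    P.real {ω | σ u i ω = f} = 0 := by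
  have h1 : ∑ f, P.real {ω | σ u i ω = f} = 1 := by
    have h := measureReal_eq_sum_of_fintype (hσ.aemeasurable u i) fun _ => True
    simpa using h.symm
  have h2 : ∑ f with (Finset.univ.image f).card = m, P.real {ω | σ u i ω = f} = 1 := by
    rw [← Finset.sum_fiberwise_of_maps_to (t := (Finset.univ : Finset (Fin (D.n i))).powersetCard m)
      (g := fun f => Finset.univ.image f) (by simp)]
    have h3 : ∀ S ∈ (Finset.univ : Finset (Fin (D.n i))).powersetCard m,
        ∑ f ∈ Finset.univ.filter (fun f : Fin m → Fin (D.n i) => (Finset.univ.image f).card = m) with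
          Finset.univ.image f = S, P.real {ω | σ u i ω = f} = (((D.n i).choose m : ℝ))⁻¹ := by
      intro S hS
      have hS' := (Finset.mem_powersetCard.1 hS).2
      rw [← hσ.sum_measureReal_image_eq u i hS', Finset.filter_filter]
      refine Finset.sum_congr (Finset.filter_congr fun f _ => ?_) fun _ _ => rfl
      constructor
      · exact fun h => h.2
      · rintro rfl; exact ⟨hS', rfl⟩
    rw [Finset.sum_congr rfl h3, Finset.sum_const, Finset.card_powersetCard, Finset.card_univ,
      Fintype.card_fin, nsmul_eq_mul]
    exact mul_inv_cancel₀ (Nat.cast_ne_zero.2 (Nat.choose_pos (hn i)).ne')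
  have h4 := Finset.sum_filter_add_sum_filter_not Finset.univ
    (fun f : Fin m → Fin (D.n i) => (Finset.univ.image f).card = m)
    (fun f => P.real {ω | σ u i ω = f})
  rw [h1, h2] at h4
  have h5 : ∑ f with ¬ (Finset.univ.image f).card = m, P.real {ω | σ u i ω = f} = 0 := by linarith
  refine (Finset.sum_eq_zero_iff_of_nonneg fun _ _ => measureReal_nonneg).1 h5 f ?_
  rw [Finset.mem_filter]
  refine ⟨Finset.mem_univ _, fun h => hf ?_⟩
  have h6 := Finset.card_image_iff.1 (h.trans (by simp : m = (Finset.univ : Finset (Fin m)).card))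
  exact fun r s hrs => h6 (by simp) (by simp) hrs

theorem measureReal_pair_eq (hσ : D.IsSubsampling P X m U σ) {u u' : Fin U} (hu : u ≠ u')
    (l l' : D.Tuples m) :
    P.real {ω | ((fun i => σ u i ω, fun i => σ u' i ω) : D.Tuples m × D.Tuples m) = (l, l')} =
      (∏ i, P.real {ω | σ u i ω = l i}) * ∏ i, P.real {ω | σ u' i ω = l' i} := by
  classical
  set t : (q : Fin U × Fin D.a) → Set (Fin m → Fin (D.n q.2)) := fun q =>
    if q.1 = u then {l q.2} else {l' q.2} with ht
  have h := hσ.indep.measure_inter_preimage_eq_mul ({u, u'} ×ˢ Finset.univ) (sets := t)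
    fun q _ => (Set.toFinite _).measurableSet
  have e1 : {ω | ((fun i => σ u i ω, fun i => σ u' i ω) : D.Tuples m × D.Tuples m) = (l, l')} =
      ⋂ q ∈ ({u, u'} ×ˢ Finset.univ : Finset (Fin U × Fin D.a)),
        (fun ω => σ q.1 q.2 ω) ⁻¹' t q := by
    ext ω
    simp only [Set.mem_ofPred_eq, Prod.mk.injEq, funext_iff, Set.mem_iInter, Finset.mem_product,
      Finset.mem_insert, Finset.mem_singleton, Finset.mem_univ, and_true, Set.mem_preimage, ht]
    constructor
    · rintro ⟨h1, h2⟩ ⟨w, i⟩ hw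
      simp only at hw
      rcases hw with rfl | rfl
      · simp only [if_true, Set.mem_singleton_iff]; exact funext (h1 i)
      · simp only [if_neg hu.symm, Set.mem_singleton_iff]; exact funext (h2 i)
    · intro h1
      refine ⟨fun i r => ?_, fun i r => ?_⟩
      · have := h1 (u, i) (Or.inl rfl)
        simp only [if_true, Set.mem_singleton_iff] at this
        rw [this]
      · have := h1 (u', i) (Or.inr rfl)
        simp only [if_neg hu.symm, Set.mem_singleton_iff] at this
        rw [this]
  rw [e1, measureReal_def, h, Finset.prod_product, Finset.prod_pair hu, ENNReal.toReal_mul,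
    ENNReal.toReal_prod, ENNReal.toReal_prod]
  congr 1
  · refine Finset.prod_congr rfl fun i _ => ?_
    simp only [ht, if_true]
    rfl
  · refine Finset.prod_congr rfl fun i _ => ?_
    simp only [ht, if_neg hu.symm]
    rfl

theorem aemeasurable_tuple (hσ : D.IsSubsampling P X m U σ) (u : Fin U) :
    AEMeasurable (fun ω => ((fun i => σ u i ω) : D.Tuples m)) P :=
  aemeasurable_pi_lambda _ fun i => hσ.aemeasurable u i

theorem measureReal_not_areDisjoint_le [IsProbabilityMeasure P]
    (hσ : D.IsSubsampling P X m U σ) (hn : ∀ i, m ≤ D.n i) {u u' : Fin U} (hu : u ≠ u') :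
    P.real {ω | ¬ AreDisjoint (D := D) (fun i => σ u i ω) (fun i => σ u' i ω)} ≤
      1 - D.disjointRatio m := by
  classical
  have hm : AEMeasurable
      (fun ω => ((fun i => σ u i ω, fun i => σ u' i ω) : D.Tuples m × D.Tuples m)) P :=
    (hσ.aemeasurable_tuple u).prodMk (hσ.aemeasurable_tuple u')
  have h1 := measureReal_eq_sum_of_fintype hm fun q => AreDisjoint q.1 q.2
  have h2 := measureReal_eq_sum_of_fintype hm fun q => ¬ AreDisjoint q.1 q.2
  have h3 := measureReal_eq_sum_of_fintype hm fun _ => True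
  have h4 : P.real {ω | AreDisjoint (D := D) (fun i => σ u i ω) (fun i => σ u' i ω)} +
      P.real {ω | ¬ AreDisjoint (D := D) (fun i => σ u i ω) (fun i => σ u' i ω)} = 1 := by
    rw [h1, h2, ← Finset.sum_add_distrib]
    have h5 : P.real {ω : Ω | True} = 1 := by simp
    rw [← h5, h3]
    refine Finset.sum_congr rfl fun q _ => ?_
    by_cases h : AreDisjoint q.1 q.2
    · rw [if_pos h, if_neg (not_not.2 h), add_zero, if_pos trivial]
    · rw [if_neg h, if_pos h, zero_add, if_pos trivial]
  have h5 : D.disjointRatio m ≤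
      P.real {ω | AreDisjoint (D := D) (fun i => σ u i ω) (fun i => σ u' i ω)} := by
    refine (disjointRatio_le_sum (w := fun i f => P.real {ω | σ u i ω = f})
      (w' := fun i f => P.real {ω | σ u' i ω = f}) (fun _ _ => measureReal_nonneg)
      (fun _ _ => measureReal_nonneg) (fun i S hS => hσ.sum_measureReal_image_eq u i hS)
      (fun i S hS => hσ.sum_measureReal_image_eq u' i hS) hn).trans (le_of_eq ?_)
    rw [h1, Fintype.sum_prod_type]
    refine Finset.sum_congr rfl fun l _ => Finset.sum_congr rfl fun l' _ => ?_
    rw [hσ.measureReal_pair_eq hu l l']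
  linarith

end IsSubsampling

/-- The deviation of the average of a kernel over a random subsample of tuples: conditionally on
the subsample this is an average of random variables that are uncorrelated unless their tuples
overlap. -/
theorem IsUnbiasedKernel.measureReal_subsample_le {Y : D.Tuples m → D.Data → ℝ} {θ v : ℝ}
    (hX : D.IsSample P X) (hY : IsUnbiasedKernel P X Y θ v) (hv : 0 ≤ v)
    (hσ : D.IsSubsampling P X m U σ) (hU : 0 < U) (hn : ∀ i, m ≤ D.n i) {ε : ℝ} (hε : 0 < ε) :
    P.real {ω | ε < |(∑ u, (U : ℝ)⁻¹ * Y (fun i => σ u i ω) (fun i j => X i j ω)) - θ|} ≤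
      v / ε ^ 2 * ((U : ℝ)⁻¹ + (1 - D.disjointRatio m)) := by
  classical
  have := hX.isProbabilityMeasure
  have hU' : (U : ℝ) ≠ 0 := Nat.cast_ne_zero.2 hU.ne'
  set T : Ω → (q : Fin U × Fin D.a) → Fin m → Fin (D.n q.2) := fun ω q => σ q.1 q.2 ω
  have hT : AEMeasurable T P := aemeasurable_pi_lambda _ fun q => hσ.aemeasurable q.1 q.2
  -- for fixed subsamples `s`, the event that the average deviates depends only on the data
  set B : ((q : Fin U × Fin D.a) → Fin m → Fin (D.n q.2)) → Set Ω := fun s =>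
    {ω | ε < |(∑ u, (U : ℝ)⁻¹ * Y (fun i => s (u, i)) (fun i j => X i j ω)) - θ|} with hB
  have hprod : ∀ s, P.real ({ω | T ω = s} ∩ B s) = P.real {ω | T ω = s} * P.real (B s) := by
    intro s
    set B' : Set ((q : Σ i : Fin D.a, Fin (D.n i)) → EuclideanSpace ℝ (Fin (D.d q.1))) :=
      {x | ε < |(∑ u, (U : ℝ)⁻¹ * Y (fun i => s (u, i)) (fun i j => x ⟨i, j⟩)) - θ|}
    have hflat : Measurable fun (x : (q : Σ i : Fin D.a, Fin (D.n i)) →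
        EuclideanSpace ℝ (Fin (D.d q.1))) => ((fun i j => x ⟨i, j⟩) : D.Data) :=
      measurable_pi_lambda _ fun i => measurable_pi_lambda _ fun j => measurable_pi_apply _
    have hB' : MeasurableSet B' := by
      refine measurableSet_lt measurable_const (Measurable.abs (Measurable.sub_const ?_ _))
      exact Finset.measurable_sum _ fun u _ => ((hY.measurable _).comp hflat).const_mul _
    have h := hσ.indep_data.measure_inter_preimage_eq_mul {s} B' (measurableSet_singleton s) hB'
    rw [measureReal_def, measureReal_def, measureReal_def, ← ENNReal.toReal_mul]
    exact congrArg ENNReal.toReal h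
  have hcond : ∀ s, (∀ u, IsDistinct (D := D) fun i => s (u, i)) → P.real (B s) ≤
      v / ε ^ 2 * ∑ u, ∑ u', if ¬ AreDisjoint (D := D) (fun i => s (u, i)) (fun i => s (u', i))
        then (U : ℝ)⁻¹ * (U : ℝ)⁻¹ else 0 := fun s hs =>
    measureReal_weighted_average_sub_le (fun _ => by positivity) (by simp [hU'])
      (fun u _ => hY.memLp _ (hs u)) (fun u _ => hY.integral _ (hs u))
      (fun u _ => hY.variance_le _ (hs u)) (fun u u' => ¬ AreDisjoint (D := D)
        (fun i => s (u, i)) (fun i => s (u', i)))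
      (fun u u' _ _ h => hY.covariance _ _ (hs u) (hs u') (not_not.1 h)) hε
  have hzero : ∀ s, ¬ (∀ u, IsDistinct (D := D) fun i => s (u, i)) → P.real {ω | T ω = s} = 0 := by
    intro s hs
    simp only [IsDistinct] at hs
    push Not at hs
    obtain ⟨u, i, hui⟩ := hs
    refine le_antisymm ?_ measureReal_nonneg
    rw [← hσ.measureReal_eq_zero_of_not_injective hn u i hui]
    refine measureReal_mono ?_
    intro ω hω
    simp only [Set.mem_ofPred_eq] at hω ⊢
    exact congrFun hω (u, i)
  have hpair : ∀ u u', ∑ s, P.real {ω | T ω = s} *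
      (if ¬ AreDisjoint (D := D) (fun i => s (u, i)) (fun i => s (u', i))
        then (U : ℝ)⁻¹ * (U : ℝ)⁻¹ else 0) ≤
      (U : ℝ)⁻¹ * (U : ℝ)⁻¹ * if u = u' then 1 else 1 - D.disjointRatio m := by
    intro u u'
    have h := measureReal_eq_sum_of_fintype hT fun s =>
      ¬ AreDisjoint (D := D) (fun i => s (u, i)) (fun i => s (u', i))
    have e : ∀ s, P.real {ω | T ω = s} *
        (if ¬ AreDisjoint (D := D) (fun i => s (u, i)) (fun i => s (u', i))
          then (U : ℝ)⁻¹ * (U : ℝ)⁻¹ else 0) = (U : ℝ)⁻¹ * (U : ℝ)⁻¹ *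
        if ¬ AreDisjoint (D := D) (fun i => s (u, i)) (fun i => s (u', i))
          then P.real {ω | T ω = s} else 0 := fun s => by
      rw [mul_ite, mul_ite, mul_zero, mul_zero, mul_comm]
    simp_rw [e, ← Finset.mul_sum]
    rw [← h]
    refine mul_le_mul_of_nonneg_left ?_ (by positivity)
    split_ifs with hu
    · exact measureReal_le_one
    · exact hσ.measureReal_not_areDisjoint_le hn hu
  have hratio : D.disjointRatio m ≤ 1 := by
    refine Finset.prod_le_one (fun i _ => by positivity) fun i _ => ?_
    refine div_le_one_of_le₀ ?_ (Nat.cast_nonneg _)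
    exact_mod_cast Nat.choose_le_choose m (Nat.sub_le _ _)
  calc P.real {ω | ε < |(∑ u, (U : ℝ)⁻¹ * Y (fun i => σ u i ω) (fun i j => X i j ω)) - θ|}
      ≤ P.real (⋃ s, {ω | T ω = s} ∩ B s) := by
        refine measureReal_mono ?_
        intro ω hω
        exact Set.mem_iUnion.2 ⟨T ω, rfl, hω⟩
    _ ≤ ∑ s, P.real ({ω | T ω = s} ∩ B s) := measureReal_iUnion_fintype_le _
    _ ≤ ∑ s, P.real {ω | T ω = s} * (v / ε ^ 2 * ∑ u, ∑ u',
          if ¬ AreDisjoint (D := D) (fun i => s (u, i)) (fun i => s (u', i))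
            then (U : ℝ)⁻¹ * (U : ℝ)⁻¹ else 0) := by
        refine Finset.sum_le_sum fun s _ => ?_
        rw [hprod s]
        by_cases hs : ∀ u, IsDistinct (D := D) fun i => s (u, i)
        · exact mul_le_mul_of_nonneg_left (hcond s hs) measureReal_nonneg
        · rw [hzero s hs, zero_mul, zero_mul]
    _ = v / ε ^ 2 * ∑ u, ∑ u', ∑ s, P.real {ω | T ω = s} *
          (if ¬ AreDisjoint (D := D) (fun i => s (u, i)) (fun i => s (u', i))
            then (U : ℝ)⁻¹ * (U : ℝ)⁻¹ else 0) := by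
        simp_rw [mul_left_comm _ (v / ε ^ 2), ← Finset.mul_sum]
        congr 1
        simp_rw [Finset.mul_sum]
        rw [Finset.sum_comm]
        exact Finset.sum_congr rfl fun u _ => Finset.sum_comm
    _ ≤ v / ε ^ 2 * ∑ u : Fin U, ∑ u' : Fin U, (U : ℝ)⁻¹ * (U : ℝ)⁻¹ *
          ((if u = u' then 1 else 0) + (1 - D.disjointRatio m)) := by
        refine mul_le_mul_of_nonneg_left ?_ (by positivity)
        refine Finset.sum_le_sum fun u _ => Finset.sum_le_sum fun u' _ => (hpair u u').trans ?_
        refine mul_le_mul_of_nonneg_left ?_ (by positivity)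
        split_ifs <;> linarith
    _ = v / ε ^ 2 * ((U : ℝ)⁻¹ + (1 - D.disjointRatio m)) := by
        congr 1
        simp_rw [← Finset.mul_sum, Finset.sum_add_distrib, Finset.sum_ite_eq]
        simp only [Finset.mem_univ, if_true, Finset.sum_const, Finset.card_univ, Fintype.card_fin,
          nsmul_eq_mul]
        field_simp

theorem A1star_eq (x : D.Data) (s : Fin U → (i : Fin D.a) → Fin 2 → Fin (D.n i)) :
    D.A1star x s = ∑ u, (U : ℝ)⁻¹ * kernelOne (s u) x := by
  simp only [A1star, kernelOne, Finset.mul_sum]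
  refine Finset.sum_congr rfl fun u _ => ?_
  rw [one_div, mul_inv]
  ring

theorem A2star_eq (x : D.Data) (s : Fin U → (i : Fin D.a) → Fin 4 → Fin (D.n i)) :
    D.A2star x s = ∑ u, (U : ℝ)⁻¹ * kernelTwo (s u) x := by
  simp only [A2star, kernelTwo, Finset.mul_sum]
  refine Finset.sum_congr rfl fun u _ => ?_
  rw [one_div, mul_inv]
  ring

theorem IsSample.measureReal_A1star_sub_le (hX : D.IsSample P X)
    {σ : Fin U → (i : Fin D.a) → Ω → Fin 2 → Fin (D.n i)} (hσ : D.IsSubsampling P X 2 U σ)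
    (hU : 0 < U) (hn : ∀ i, 2 ≤ D.n i) {ε : ℝ} (hε : 0 < ε) :
    P.real {ω | ε < |D.A1star (fun i j => X i j ω) (fun u i => σ u i ω) - ∑ s, D.lam s|} ≤
      (2 * ∑ s, D.lam s ^ 2) / ε ^ 2 * ((U : ℝ)⁻¹ + (1 - D.disjointRatio 2)) := by
  simp_rw [A1star_eq]
  exact hX.isUnbiasedKernel_kernelOne.measureReal_subsample_le hX
    (mul_nonneg zero_le_two (Finset.sum_nonneg fun _ _ => sq_nonneg _)) hσ hU hn hε

theorem IsSample.measureReal_A2star_sub_le (hX : D.IsSample P X)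
    {τ : Fin U → (i : Fin D.a) → Ω → Fin 4 → Fin (D.n i)} (hτ : D.IsSubsampling P X 4 U τ)
    (hU : 0 < U) (hn : ∀ i, 4 ≤ D.n i) {ε : ℝ} (hε : 0 < ε) :
    P.real {ω | ε < |D.A2star (fun i j => X i j ω) (fun u i => τ u i ω) - ∑ s, D.lam s ^ 2|} ≤
      (9 * (∑ s, D.lam s ^ 2) ^ 2) / ε ^ 2 * ((U : ℝ)⁻¹ + (1 - D.disjointRatio 4)) := by
  simp_rw [A2star_eq]
  exact hX.isUnbiasedKernel_kernelTwo.measureReal_subsample_le hX (by positivity) hτ hU hn hε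

theorem IsSubsampling.aemeasurable_sum (hX : D.IsSample P X) (hσ : D.IsSubsampling P X m U σ)
    {Y : D.Tuples m → D.Data → ℝ} (hY : ∀ l, Measurable (Y l)) :
    AEMeasurable (fun ω => ∑ u, (U : ℝ)⁻¹ * Y (fun i => σ u i ω) (fun i j => X i j ω)) P := by
  have hXm : AEMeasurable (fun ω => ((fun i j => X i j ω) : D.Data)) P :=
    aemeasurable_pi_lambda _ fun i => aemeasurable_pi_lambda _ fun j => (hX.hasLaw i j).aemeasurable
  refine Finset.aemeasurable_fun_sum _ fun u _ => AEMeasurable.const_mul ?_ _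
  have h : Measurable fun q : D.Tuples m × D.Data => Y q.1 q.2 :=
    measurable_from_prod_countable_right hY
  exact h.comp_aemeasurable ((hσ.aemeasurable_tuple u).prodMk hXm)

end SplitPlotDesign

/-! ### Studentization, standardized eigenvalues and measurability -/

theorem abs_studentized_sub_standardized_le {q m v a b δ : ℝ} (hv : 0 < v) (hδ : δ ≤ 1 / 2)
    (ha : |a - m| ≤ δ * √(2 * v)) (hb : |b - v| ≤ δ * v) :
    |(q - a) / √(2 * b) - (q - m) / √(2 * v)| ≤ 2 * δ * (|(q - m) / √(2 * v)| + 1) := by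
  have hs : 0 < √(2 * v) := by positivity
  set w := (q - m) / √(2 * v) with hw
  set e := (a - m) / √(2 * v) with he
  set r := √(b / v) with hr
  have hbv : |b / v - 1| ≤ δ := by
    rw [div_sub_one hv.ne', abs_div, abs_of_pos hv]
    exact (div_le_iff₀ hv).2 hb
  have hr2 : r ^ 2 = b / v := Real.sq_sqrt (by linarith [(abs_le.1 hbv).1])
  have hr0 : 0 ≤ r := Real.sqrt_nonneg _
  have hrge : 1 / 2 ≤ r := by
    have := (abs_le.1 hbv).1
    nlinarith
  have hrpos : 0 < r := by linarith
  have he1 : |e| ≤ δ := by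
    rw [he, abs_div, abs_of_pos hs]
    exact (div_le_iff₀ hs).2 ha
  have hr1 : |1 - r| ≤ δ := by
    refine le_trans ?_ hbv
    rw [← hr2, show r ^ 2 - 1 = -((1 - r) * (1 + r)) by ring, abs_neg, abs_mul,
      abs_of_pos (by linarith : 0 < 1 + r)]
    exact le_mul_of_one_le_right (abs_nonneg _) (by linarith)
  have hsb : √(2 * b) = √(2 * v) * r := by
    rw [hr, ← Real.sqrt_mul (by positivity)]
    congr 1
    field_simp
  have key : (q - a) / √(2 * b) - w = (w * (1 - r) - e) / r := by
    rw [hsb, hw, he]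
    field_simp
    ring
  rw [key, abs_div, abs_of_pos hrpos, div_le_iff₀ hrpos]
  have h1 : |w * (1 - r) - e| ≤ |w| * δ + δ := by
    refine (abs_sub _ _).trans (add_le_add ?_ he1)
    rw [abs_mul]
    exact mul_le_mul_of_nonneg_left hr1 (abs_nonneg _)
  have hδ0 : 0 ≤ δ := (abs_nonneg _).trans he1
  have h2 : 0 ≤ δ * (|w| + 1) := by positivity
  nlinarith

/-- Replacing the centring and the scaling of a standardized sequence with bounded variances by
ratio-consistent estimators changes it by a sequence that tends to zero in probability. -/
theorem tendsto_measureReal_studentized_sub {Ω : ℕ → Type*} [∀ k, MeasurableSpace (Ω k)]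
    {P : (k : ℕ) → Measure (Ω k)} [∀ k, IsProbabilityMeasure (P k)] {q a b : (k : ℕ) → Ω k → ℝ}
    {m v : ℕ → ℝ} (hv : ∀ k, 0 < v k)
    (hq : ∀ k M, 0 < M → (P k).real {ω | M < |(q k ω - m k) / √(2 * v k)|} ≤ 1 / M ^ 2)
    (ha : ∀ δ > 0, Tendsto (fun k => (P k).real {ω | δ * √(2 * v k) < |a k ω - m k|}) atTop (𝓝 0))
    (hb : ∀ δ > 0, Tendsto (fun k => (P k).real {ω | δ * v k < |b k ω - v k|}) atTop (𝓝 0))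
    {ε : ℝ} (hε : 0 < ε) :
    Tendsto (fun k => (P k).real {ω | ε < |(q k ω - a k ω) / √(2 * b k ω) -
      (q k ω - m k) / √(2 * v k)|}) atTop (𝓝 0) := by
  rw [Metric.tendsto_atTop]
  intro η hη
  -- beyond `M`, the standardized variable contributes at most `1 / M ^ 2 = η / 2`
  set M := √(2 / η) with hM
  have hMpos : 0 < M := by positivity
  have hM2 : 1 / M ^ 2 = η / 2 := by
    rw [hM, Real.sq_sqrt (by positivity), one_div_div]
  set δ := min (1 / 2) (ε / (2 * (M + 1))) with hδ
  have hδpos : 0 < δ := by positivity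
  have hδε : 2 * δ * (M + 1) ≤ ε := by
    have : δ ≤ ε / (2 * (M + 1)) := min_le_right _ _
    rw [le_div_iff₀ (by positivity)] at this
    linarith
  have hlim := (ha δ hδpos).add (hb δ hδpos)
  rw [add_zero] at hlim
  obtain ⟨K, hK⟩ := eventually_atTop.1 (hlim.eventually_lt_const (half_pos hη))
  refine ⟨K, fun k hk => ?_⟩
  rw [Real.dist_0_eq_abs, abs_of_nonneg measureReal_nonneg]
  have hsub : {ω | ε < |(q k ω - a k ω) / √(2 * b k ω) - (q k ω - m k) / √(2 * v k)|} ⊆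
      {ω | M < |(q k ω - m k) / √(2 * v k)|} ∪ ({ω | δ * √(2 * v k) < |a k ω - m k|} ∪
        {ω | δ * v k < |b k ω - v k|}) := by
    intro ω hω
    by_contra h
    simp only [Set.mem_union, Set.mem_ofPred_eq, not_or, not_lt] at h hω
    obtain ⟨h1, h2, h3⟩ := h
    have := abs_studentized_sub_standardized_le (q := q k ω) (hv k) (min_le_left _ _) h2 h3
    have h4 : 2 * δ * (|(q k ω - m k) / √(2 * v k)| + 1) ≤ 2 * δ * (M + 1) := by gcongr
    linarith
  calc (P k).real _ ≤ _ := measureReal_mono hsub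
    _ ≤ _ := measureReal_union_le _ _
    _ ≤ _ := add_le_add (hq k M hMpos) (measureReal_union_le _ _)
    _ < η := by
      have := hK k hk
      rw [hM2]
      linarith

namespace SplitPlotDesign

variable {D : SplitPlotDesign}

/-- `eigenval` and `lam` list the same eigenvalues, along different index types. -/
theorem sum_eigenval {M : Type*} [AddCommMonoid M] (f : ℝ → M) :
    ∑ l, f (D.eigenval l) = ∑ s, f (D.lam s) :=
  (Fintype.sum_equiv (Fintype.equivOfCardEq (Fintype.card_fin _)).symm (fun s => f (D.lam s))
    (fun l => f (D.eigenval l)) fun _ => rfl).symm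

theorem eigenval_nonneg (l : Fin (Fintype.card D.Idx)) : 0 ≤ D.eigenval l := by
  have h := D.lam_nonneg (Fintype.equivOfCardEq (Fintype.card_fin _) l)
  unfold lam Matrix.IsHermitian.eigenvalues at h
  simpa [eigenval] using h

theorem beta_of_le {s : ℕ} (h : Fintype.card D.Idx ≤ s) : D.beta s = 0 := dif_neg (not_lt.2 h)

theorem beta_nonneg (s : ℕ) : 0 ≤ D.beta s := by
  unfold beta
  split_ifs with h
  · exact div_nonneg (D.eigenval_nonneg _) (Real.sqrt_nonneg _)
  · exact le_rfl

theorem beta_antitone : Antitone D.beta := by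
  intro s s' h
  by_cases hs' : s' < Fintype.card D.Idx
  · unfold beta
    rw [dif_pos hs', dif_pos (h.trans_lt hs')]
    refine div_le_div_of_nonneg_right ?_ (Real.sqrt_nonneg _)
    exact D.isHermitian_TVT.eigenvalues₀_antitone h
  · rw [beta_of_le (not_lt.1 hs')]
    exact beta_nonneg s

theorem prod_range_beta {M : Type*} [CommMonoid M] (f : ℝ → M) :
    ∏ s ∈ Finset.range (Fintype.card D.Idx), f (D.beta s) =
      ∏ s, f (D.lam s / √(∑ s, D.lam s ^ 2)) := by
  rw [Finset.prod_range, ← sum_eigenval (fun x => x ^ 2)]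
  refine (Fintype.prod_equiv (Fintype.equivOfCardEq (Fintype.card_fin _)).symm _ _ fun s => ?_).symm
  unfold beta
  rw [dif_pos (Fin.is_lt _)]
  rfl

theorem sum_beta_sq (hT : D.T ≠ 0) : ∑ s ∈ Finset.range (Fintype.card D.Idx), D.beta s ^ 2 = 1 := by
  -- the additive version of the preceding product formula
  have h := prod_range_beta (D := D) (fun x => Multiplicative.ofAdd (x ^ 2))
  rw [← ofAdd_sum, ← ofAdd_sum] at h
  have h' := Multiplicative.ofAdd.injective h
  rw [h']
  simp_rw [div_pow, Real.sq_sqrt (D.sum_lam_sq_pos hT).le]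
  rw [← Finset.sum_div, div_self (D.sum_lam_sq_pos hT).ne']

theorem sum_range_beta_sq_le (hT : D.T ≠ 0) (m : ℕ) : ∑ s ∈ Finset.range m, D.beta s ^ 2 ≤ 1 := by
  rw [← sum_beta_sq hT]
  rcases le_total m (Fintype.card D.Idx) with h | h
  · exact Finset.sum_le_sum_of_subset_of_nonneg (Finset.range_mono h) fun _ _ _ => sq_nonneg _
  · refine (Finset.sum_subset (Finset.range_mono h) fun s _ hs => ?_).ge
    rw [beta_of_le (not_lt.1 fun h => hs (Finset.mem_range.2 h)), sq, zero_mul]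

section Random

variable {Ω : Type*} [MeasurableSpace Ω] {P : Measure Ω}
  {X : (i : Fin D.a) → Fin (D.n i) → Ω → EuclideanSpace ℝ (Fin (D.d i))}

theorem IsSample.aemeasurable_data (hX : D.IsSample P X) :
    AEMeasurable (fun ω => ((fun i j => X i j ω) : D.Data)) P :=
  aemeasurable_pi_lambda _ fun i => aemeasurable_pi_lambda _ fun j => (hX.hasLaw i j).aemeasurable

theorem measurable_Q (h0 : D.NullHypothesis) : Measurable D.Q := by
  rw [funext (Q_eq_sum_score h0)]
  exact Finset.measurable_sum _ fun p _ => (measurable_score _ p).pow_const 2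

theorem measurable_A1 : Measurable D.A1 := by
  classical
  rw [funext A1_eq]
  exact Finset.measurable_sum _ fun l _ => (measurable_kernelOne l).div_const _

theorem measurable_A2 : Measurable D.A2 := by
  classical
  rw [funext A2_eq]
  exact Finset.measurable_sum _ fun l _ => (measurable_kernelTwo l).div_const _

theorem IsSample.Wtilde_eq (hX : D.IsSample P X) (h0 : D.NullHypothesis) (ω : Ω) :
    D.Wtilde P X ω =
      (D.Q (fun i j => X i j ω) - ∑ s, D.lam s) / √(2 * ∑ s, D.lam s ^ 2) := by
  unfold Wtilde
  simp_rw [Q_eq_sum_score h0]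
  rw [hX.integral_quadratic isUnitWeights_meanWeights,
    hX.variance_quadratic isUnitWeights_meanWeights]

theorem IsSample.aemeasurable_Wtilde (hX : D.IsSample P X) (h0 : D.NullHypothesis) :
    AEMeasurable (D.Wtilde P X) P :=
  (((measurable_Q h0).comp_aemeasurable hX.aemeasurable_data).sub_const _).div_const _

theorem IsSample.aemeasurable_W (hX : D.IsSample P X) (h0 : D.NullHypothesis) :
    AEMeasurable (D.W X) P :=
  (((measurable_Q h0).comp_aemeasurable hX.aemeasurable_data).sub
    (measurable_A1.comp_aemeasurable hX.aemeasurable_data)).div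
      ((measurable_A2.comp_aemeasurable hX.aemeasurable_data).const_mul 2).sqrt

theorem IsSample.aemeasurable_Wstar (hX : D.IsSample P X) (h0 : D.NullHypothesis) {U : ℕ}
    {σ : Fin U → (i : Fin D.a) → Ω → Fin 2 → Fin (D.n i)} (hσ : D.IsSubsampling P X 2 U σ)
    {τ : Fin U → (i : Fin D.a) → Ω → Fin 4 → Fin (D.n i)} (hτ : D.IsSubsampling P X 4 U τ) :
    AEMeasurable (D.Wstar X σ τ) P := by
  unfold Wstar
  simp_rw [A1star_eq, A2star_eq]
  exact (((measurable_Q h0).comp_aemeasurable hX.aemeasurable_data).sub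
    (hσ.aemeasurable_sum hX measurable_kernelOne)).div
      ((hτ.aemeasurable_sum hX measurable_kernelTwo).const_mul 2).sqrt

theorem IsSample.charFun_Wtilde (hX : D.IsSample P X) (h0 : D.NullHypothesis) (t : ℝ) :
    charFun (P.map (D.Wtilde P X)) t =
      ∏ s ∈ Finset.range (Fintype.card D.Idx), stdChiSqCharFun (D.beta s * t) := by
  rw [prod_range_beta (fun x => stdChiSqCharFun (x * t)),
    ← hX.charFun_quadratic isUnitWeights_meanWeights t]
  congr 2
  ext ω
  rw [hX.Wtilde_eq h0, Q_eq_sum_score h0]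

/-- Chebyshev's inequality for the standardized quadratic form. -/
theorem IsSample.measureReal_Wtilde_le (hX : D.IsSample P X) (h0 : D.NullHypothesis)
    (hT : D.T ≠ 0) {M : ℝ} (hM : 0 < M) : P.real {ω | M <
      |(D.Q (fun i j => X i j ω) - ∑ s, D.lam s) / √(2 * ∑ s, D.lam s ^ 2)|} ≤ 1 / M ^ 2 := by
  have := hX.isProbabilityMeasure
  have hs := D.sum_lam_sq_pos hT
  have hsq : 0 < √(2 * ∑ s, D.lam s ^ 2) := by positivity
  have hc := meas_ge_le_variance_div_sq (hX.memLp_quadratic isUnitWeights_meanWeights)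
    (mul_pos hM hsq)
  rw [hX.integral_quadratic isUnitWeights_meanWeights,
    hX.variance_quadratic isUnitWeights_meanWeights, mul_pow, Real.sq_sqrt (by positivity),
    mul_comm (M ^ 2), ← div_div, div_self (by positivity)] at hc
  refine le_trans (measureReal_mono ?_) (ENNReal.toReal_le_of_le_ofReal (by positivity) hc)
  intro ω hω
  simp only [Set.mem_ofPred_eq] at hω ⊢
  rw [Q_eq_sum_score h0, abs_div, abs_of_pos hsq, lt_div_iff₀ hsq] at hω
  exact hω.le

end Random

end SplitPlotDesign

/-! ### The common limit distribution -/

namespace SplitPlotDesign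

/-- The frameworks enter only through the divergence of the smallest group size. -/
theorem eventually_le_n {D : ℕ → SplitPlotDesign}
    (hframe : Framework1 D ∨ Framework2 D ∨ Framework3 D) (m : ℕ) :
    ∀ᶠ k in atTop, ∀ i, m ≤ (D k).n i := by
  have h : ∀ᶠ k in atTop, m ≤ ⨅ i, (D k).n i := by
    rcases hframe with h | h | h
    · exact (h.2.eventually_ge_atTop m).mono fun k hk => (le_min_iff.1 hk).2
    · exact (h.2.eventually_ge_atTop m).mono fun k hk => (le_min_iff.1 hk).2
    · exact (Tendsto.eventually_ge_atTop h m).mono fun k hk => (le_min_iff.1 (le_min_iff.1 hk).2).2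
  exact h.mono fun k hk i => hk.trans (ciInf_le (OrderBot.bddBelow _) i)

/-- For group sizes at least `2 * m` the size condition says that two independent uniform
`m`-subsamples are disjoint with probability tending to one. -/
theorem SizeCondition.tendsto_disjointRatio {D : ℕ → SplitPlotDesign} {m : ℕ}
    (h : SizeCondition m D) (hn : ∀ᶠ k in atTop, ∀ i, 2 * m ≤ (D k).n i) :
    Tendsto (fun k => 1 - (D k).disjointRatio m) atTop (𝓝 0) := by
  have h1 : Tendsto (fun k => (D k).disjointRatio m) atTop (𝓝 1) :=
    h.congr' (hn.mono fun k hk => Finset.prod_congr rfl fun i _ =>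
      (choose_div_choose_eq (hk i)).symm)
  simpa using h1.const_sub 1

variable {Ω : ℕ → Type*} [∀ k, MeasurableSpace (Ω k)]
  {P : (k : ℕ) → Measure (Ω k)} [∀ k, IsProbabilityMeasure (P k)] {D : ℕ → SplitPlotDesign}
  {X : (k : ℕ) → (i : Fin (D k).a) → Fin ((D k).n i) → Ω k → EuclideanSpace ℝ (Fin ((D k).d i))}
  {Ω' : Type*} [MeasurableSpace Ω'] {P' : Measure Ω'} [IsProbabilityMeasure P'] {L : Ω' → ℝ}

/-- Ratio-consistent estimators of the null expectation and the null variance of the quadratic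
form do not change the limit distribution. -/
theorem tendstoInDistribution_studentized (hT : ∀ k, (D k).T ≠ 0)
    (hH0 : ∀ k, (D k).NullHypothesis) (hX : ∀ k, (D k).IsSample (P k) (X k))
    (hW : TendstoInDistribution (fun k => (D k).Wtilde (P k) (X k)) atTop L P P')
    {A B : (k : ℕ) → Ω k → ℝ}
    (hm : ∀ k, AEMeasurable
      (fun ω => ((D k).Q (fun i j => X k i j ω) - A k ω) / √(2 * B k ω)) (P k))
    {r r' : ℕ → ℝ} (hr : Tendsto r atTop (𝓝 0)) (hr' : Tendsto r' atTop (𝓝 0))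
    (hA : ∀ᶠ k in atTop, ∀ ε > 0, (P k).real {ω | ε < |A k ω - ∑ s, (D k).lam s|} ≤
      (2 * ∑ s, (D k).lam s ^ 2) / ε ^ 2 * r k)
    (hB : ∀ᶠ k in atTop, ∀ ε > 0, (P k).real {ω | ε < |B k ω - ∑ s, (D k).lam s ^ 2|} ≤
      (9 * (∑ s, (D k).lam s ^ 2) ^ 2) / ε ^ 2 * r' k) :
    TendstoInDistribution
      (fun k ω => ((D k).Q (fun i j => X k i j ω) - A k ω) / √(2 * B k ω)) atTop L P P' := by
  refine hW.of_tendsto_measureReal_sub hm fun ε hε => ?_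
  simp_rw [fun k => (hX k).Wtilde_eq (hH0 k)]
  have hpos := fun k => (D k).sum_lam_sq_pos (hT k)
  refine tendsto_measureReal_studentized_sub hpos
    (fun k M hM => (hX k).measureReal_Wtilde_le (hH0 k) (hT k) hM) (fun δ hδ => ?_)
    (fun δ hδ => ?_) hε
  · have h := hr.const_mul (1 / δ ^ 2)
    rw [mul_zero] at h
    refine squeeze_zero' (Eventually.of_forall fun k => measureReal_nonneg)
      (hA.mono fun k hk => ?_) h
    have hp := hpos k
    refine (hk _ (by positivity)).trans_eq ?_
    rw [mul_pow, Real.sq_sqrt (by positivity)]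
    field_simp
  · have h := hr'.const_mul (9 / δ ^ 2)
    rw [mul_zero] at h
    refine squeeze_zero' (Eventually.of_forall fun k => measureReal_nonneg)
      (hB.mono fun k hk => ?_) h
    have hp := hpos k
    refine (hk _ (by positivity)).trans_eq ?_
    field_simp

theorem isCommonLimit_of_tendstoInDistribution (hT : ∀ k, (D k).T ≠ 0)
    (hH0 : ∀ k, (D k).NullHypothesis) (hframe : Framework1 D ∨ Framework2 D ∨ Framework3 D)
    (hsize1 : SizeCondition 2 D) (hsize2 : SizeCondition 4 D)
    (hX : ∀ k, (D k).IsSample (P k) (X k))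
    (hW : TendstoInDistribution (fun k => (D k).Wtilde (P k) (X k)) atTop L P P') :
    IsCommonLimit P D X P' L := by
  have h1 := hsize1.tendsto_disjointRatio (eventually_le_n hframe _)
  have h2 := hsize2.tendsto_disjointRatio (eventually_le_n hframe _)
  have hn2 := eventually_le_n hframe 2
  have hn4 := eventually_le_n hframe 4
  refine ⟨hW, ?_, fun U hU σ hσ τ hτ => ?_⟩
  · exact tendstoInDistribution_studentized hT hH0 hX hW
      (fun k => (hX k).aemeasurable_W (hH0 k)) h1 h2
      (hn2.mono fun k hk ε hε => (hX k).measureReal_A1_sub_le hk hε)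
      (hn4.mono fun k hk ε hε => (hX k).measureReal_A2_sub_le hk hε)
  · have hUinv : Tendsto (fun k => ((U k : ℕ) : ℝ)⁻¹) atTop (𝓝 0) :=
      tendsto_inv_atTop_nhds_zero_nat.comp hU
    have h1' := hUinv.add h1
    have h2' := hUinv.add h2
    rw [add_zero] at h1' h2'
    have hUpos := hU.eventually_gt_atTop 0
    exact tendstoInDistribution_studentized hT hH0 hX hW
      (fun k => (hX k).aemeasurable_Wstar (hH0 k) (hσ k) (hτ k)) h1' h2'
      ((hn2.and hUpos).mono fun k hk ε hε =>
        (hX k).measureReal_A1star_sub_le (hσ k) hk.2 hk.1 hε)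
      ((hn4.and hUpos).mono fun k hk ε hε =>
        (hX k).measureReal_A2star_sub_le (hτ k) hk.2 hk.1 hε)

theorem sum_range_sq_le_of_tendsto_beta (hT : ∀ k, (D k).T ≠ 0) {b : ℕ → ℝ}
    (hβ : ∀ s, Tendsto (fun k => (D k).beta s) atTop (𝓝 (b s))) (m : ℕ) :
    ∑ s ∈ Finset.range m, b s ^ 2 ≤ 1 :=
  le_of_tendsto (tendsto_finsetSum _ fun s _ => (hβ s).pow 2)
    (Eventually.of_forall fun k => sum_range_beta_sq_le (hT k) m)

theorem tendstoInDistribution_Wtilde (hT : ∀ k, (D k).T ≠ 0)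
    (hH0 : ∀ k, (D k).NullHypothesis) (hX : ∀ k, (D k).IsSample (P k) (X k))
    {C : ℕ → Ω' → ℝ} (hC : ∀ s, HasLaw (C s) chiSquaredOne P') (hCindep : iIndepFun C P')
    {Z : Ω' → ℝ} (hZ : HasLaw Z (gaussianReal 0 1) P')
    (hCZ : IndepFun (fun ω s => C s ω) Z P') {b : ℕ → ℝ}
    (hβ : ∀ s, Tendsto (fun k => (D k).beta s) atTop (𝓝 (b s)))
    (hb : Summable fun s => b s ^ 2) {S : Ω' → ℝ} (hSm : Measurable S)
    (hS : ∀ᵐ ω ∂P', Tendsto (fun m => ∑ s ∈ Finset.range m, b s * ((C s ω - 1) / √2)) atTop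
      (𝓝 (S ω))) :
    TendstoInDistribution (fun k => (D k).Wtilde (P k) (X k)) atTop
      (fun ω => S ω + √(1 - ∑' s, b s ^ 2) * Z ω) P P' where
  forall_aemeasurable k := (hX k).aemeasurable_Wtilde (hH0 k)
  aemeasurable_limit := hSm.aemeasurable.add (hZ.aemeasurable.const_mul _)
  tendsto := by
    have hb1 : ∑' s, b s ^ 2 ≤ 1 := hb.tsum_le_of_sum_range_le
      fun m => sum_range_sq_le_of_tendsto_beta hT hβ m
    refine ProbabilityMeasure.tendsto_iff_tendsto_charFun.2 fun t => ?_
    simp only [ProbabilityMeasure.coe_mk]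
    simp_rw [fun k => (hX k).charFun_Wtilde (hH0 k) t]
    exact tendsto_prod_charFun (by simp)
      (fun t => norm_charFun_le_one t) continuous_charFun
      stdChiSqCharFun_isLittleO _ _ (fun k => beta_antitone) (fun k => beta_nonneg)
      (fun k => sum_beta_sq (hT k)) (fun k s => beta_of_le) b hβ t _
      (tendsto_charFun_sum_chiSquared_add_gaussian hC hCindep hZ hCZ hb hb1 hSm hS t)

end SplitPlotDesign


theorem mainTheorem3
    {Ω : ℕ → Type*} [∀ k, MeasurableSpace (Ω k)]
    (P : (k : ℕ) → Measure (Ω k)) [∀ k, IsProbabilityMeasure (P k)]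
    -- the sequence of designs, with a hypothesis matrix that is not zero, under the null hypothesis
    (D : ℕ → SplitPlotDesign)
    (hT : ∀ k, (D k).T ≠ 0)
    (hH0 : ∀ k, (D k).NullHypothesis)
    (hframe : SplitPlotDesign.Framework1 D ∨ SplitPlotDesign.Framework2 D ∨
      SplitPlotDesign.Framework3 D)
    (hsize1 : SplitPlotDesign.SizeCondition 2 D)
    (hsize2 : SplitPlotDesign.SizeCondition 4 D)
    -- the observations
    (X : (k : ℕ) → (i : Fin (D k).a) → Fin ((D k).n i) → Ω k →
      EuclideanSpace ℝ (Fin ((D k).d i)))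
    (hX : ∀ k, (D k).IsSample (P k) (X k))
    -- the variables that occur in the limits
    {Ω' : Type*} [MeasurableSpace Ω'] (P' : Measure Ω') [IsProbabilityMeasure P']
    (C : ℕ → Ω' → ℝ) (hC : ∀ s, HasLaw (C s) chiSquaredOne P') (hCindep : iIndepFun C P')
    (Z : Ω' → ℝ) (hZ : HasLaw Z (gaussianReal 0 1) P')
    (hCZ : IndepFun (fun ω s => C s ω) Z P')
    (b : ℕ → ℝ) (hb : Antitone b)
    (hβ : ∀ s, Tendsto (fun k => (D k).beta s) atTop (𝓝 (b s))) :
    -- case (a)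
    ((∀ s, b s ∈ Set.Icc (0 : ℝ) 1) →
      Summable (fun s => b s ^ 2) ∧ ∑' s, b s ^ 2 ≤ 1 ∧
      ∃ S : Ω' → ℝ,
        (∀ᵐ ω ∂P', Tendsto (fun m => ∑ s ∈ Finset.range m, b s * ((C s ω - 1) / √2))
          atTop (𝓝 (S ω))) ∧
        SplitPlotDesign.IsCommonLimit P D X P'
          (fun ω => S ω + √(1 - ∑' s, b s ^ 2) * Z ω)) ∧
    -- case (b)
    ((∀ s, b s ∈ Set.Ioo (0 : ℝ) 1) → HasSum (fun s => b s ^ 2) 1 →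
      ∃ S : Ω' → ℝ,
        (∀ᵐ ω ∂P', Tendsto (fun m => ∑ s ∈ Finset.range m, b s * ((C s ω - 1) / √2))
          atTop (𝓝 (S ω))) ∧
        SplitPlotDesign.IsCommonLimit P D X P' S) := by
  have hsum := fun m => SplitPlotDesign.sum_range_sq_le_of_tendsto_beta hT hβ m
  have hb2 : Summable fun s => b s ^ 2 :=
    summable_of_sum_range_le (fun s => sq_nonneg (b s)) hsum
  obtain ⟨S, hSm, hS⟩ := exists_ae_tendsto_sum_chiSquared hC hCindep hb2
  have hlim := SplitPlotDesign.isCommonLimit_of_tendstoInDistribution hT hH0 hframe hsize1 hsize2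
    hX (SplitPlotDesign.tendstoInDistribution_Wtilde hT hH0 hX hC hCindep hZ hCZ hβ hb2 hSm hS)
  -- in the second case the Gaussian summand has the coefficient `√(1 - 1) = 0`
  refine ⟨fun _ => ⟨hb2, hb2.tsum_le_of_sum_range_le hsum, S, hS, hlim⟩, fun _ h1 => ⟨S, hS, ?_⟩⟩
  simpa [h1.tsum_eq] using hlim
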